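/- Write $\mathrm{poly}(\log n)$ for a function $f:\mathbb N\to\mathbb N$ with $f(n)=O(\log^C n)$ for some constant $C$. In the $\mathsf{LOCAL}$ model the nodes of a graph $G=(V,E)$ are processors with unique identifiers. All nodes are given a number $n\ge |V|$, and each node initially knows only $n$, its identifier and its own random bits. In each synchronous round every node sends a message of unbounded size to each neighbor, over arbitrarily numbered ports, and performs unbounded local computation. A (strong-diameter) $(d,c)$-network decomposition of $G$ is a partition of $V$ into clusters $C_1,\dots,C_p$, where each $C_i$ comes with a color $\gamma_i\in\{1,\dots,c\}$ and a subtree $T_i$ of $G$ with node set exactly $C_i$ and diameter at most $d$, such that distinct clusters joined by an edge of $G$ have different colors. (Hence the connected components of the subgraph induced by each color are the clusters of that color, and they have diameter at most $d$.) An algorithm computes it if each node outputs a label of its cluster, the color of its cluster, and the identifiers of its neighbors in the tree of its cluster. **Theorem.** For all constants $a,e\in\mathbb N$ there are a deterministic rule (a $\mathsf{LOCAL}$ algorithm) $\mathcal A$ running in $\mathrm{poly}(\log n)$ rounds and using $b(n)=\mathrm{poly}(\log n)$ random bits per node, and functions $k(n),d(n),c(n)=\mathrm{poly}(\log n)$,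 such that the following holds for every $n\ge 1$. Let $G$ be any graph with at most $n$ nodes, with unique identifiers in $\{1,\dots,n^a\}$ and any port numbering. Let the $b(n)\cdot|V|$ random bits held by all nodes have any joint distribution such that each bit is uniform and any at most $k(n)$ of these bits are mutually independent. Then $\mathcal A$, given $n$, computes a $(d(n),c(n))$-network decomposition of $G$ with probability at least $1-1/n^e$. -/

import Mathlib

open MeasureTheory ProbabilityTheory Asymptotics Filter

/-- `f n = poly(log n)`: there is a constant `C` with `f n = O((log n) ^ C)`. -/
def IsPolylog (f : ℕ → ℕ) : Prop :=
  ∃ C : ℕ, (fun n : ℕ => (f n : ℝ)) =O[atTop] fun n : ℕ => Real.log (n : ℝ) ^ C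

/-- A communication network on the node set `V`: a simple graph, positive unique identifiers, and at
each node a numbering of the incident edges by ports `0, …, deg v - 1`.  The port numbering is
arbitrary. -/
structure Network (V : Type) where
  graph : SimpleGraph V
  ident : V → ℕ
  ident_pos : ∀ v, 1 ≤ ident v
  ident_injective : Function.Injective ident
  port : ∀ v, graph.neighborSet v ≃ Fin (Nat.card (graph.neighborSet v))

/-- A synchronous message passing algorithm of the `LOCAL` model, whose nodes have outputs in `Out`.
All nodes are given a number `n` (an upper bound on the number of nodes).  Each node holds `bits n`
random bits, and the initial state of a node depends only on `n`, its identifier and its own bits.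
In each round a node sends one message, of unbounded size, through each of its ports, and computes
its new state from its old state and the messages that arrived (`none` at a port number that does
not exist).  Local computation is not bounded.  After `rounds n` rounds each node computes its
output from its state. -/
structure LocalAlgorithm (Out : Type) where
  State : Type
  Msg : Type
  bits : ℕ → ℕ
  rounds : ℕ → ℕ
  init : (n : ℕ) → (ident : ℕ) → (Fin (bits n) → Bool) → State
  send : State → (port : ℕ) → Msg
  receive : State → (ℕ → Option Msg) → State
  output : State → Out

namespace LocalAlgorithm

variable {Out : Type} {V : Type}

/-- The messages that arrive at the node `v`, by port number, when `s` is the vector of the current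
states of all nodes: through a port leading to the neighbour `u` arrives what `u` sends through its
port leading to `v`. -/
noncomputable def inbox (A : LocalAlgorithm Out) (N : Network V) (s : V → A.State) (v : V) :
    ℕ → Option A.Msg := fun p =>
  if h : p < Nat.card (N.graph.neighborSet v) then
    let u := (N.port v).symm ⟨p, h⟩
    some (A.send (s u) (N.port u ⟨v, SimpleGraph.Adj.symm u.2⟩))
  else none

/-- The states of all nodes after `t` rounds, when the nodes are given `n` and hold the random
bits `r`. -/
noncomputable def stateAfter (A : LocalAlgorithm Out) (N : Network V) (n : ℕ)
    (r : V → Fin (A.bits n) → Bool) : ℕ → V → A.State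
  | 0 => fun v => A.init n (N.ident v) (r v)
  | t + 1 => fun v =>
      A.receive (A.stateAfter N n r t v) (A.inbox N (A.stateAfter N n r t) v)

/-- The outputs of all nodes. -/
noncomputable def run (A : LocalAlgorithm Out) (N : Network V) (n : ℕ)
    (r : V → Fin (A.bits n) → Bool) : V → Out := fun v =>
  A.output (A.stateAfter N n r (A.rounds n) v)

end LocalAlgorithm

/-- The part of a network decomposition that a single node knows: a label of its cluster, the color
of its cluster, and the identifiers of its neighbours in the tree of its cluster. -/
structure DecompOutput where
  cluster : ℕ
  color : ℕ
  treeNeighbors : Finset ℕ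

/-- The outputs `out` of the nodes form a (strong diameter) `(d, c)`-network decomposition: the
clusters are the classes of nodes with the same label, each cluster has one color in `{1, …, c}`,
different clusters that are joined by an edge have different colors, and each cluster is
the node set of a subtree of the graph of diameter at most `d`, each node knowing its incident tree
edges.  In particular each cluster induces a connected subgraph of diameter at most `d`, and the
clusters of one color are the connected components of the subgraph induced by that color. -/
structure IsNetworkDecomposition {V : Type} (N : Network V) (d c : ℕ) (out : V → DecompOutput) :
    Prop where
  color_mem : ∀ v, 1 ≤ (out v).color ∧ (out v).color ≤ c
  color_eq : ∀ u v, (out u).cluster = (out v).cluster → (out u).color = (out v).color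
  color_ne : ∀ u v, N.graph.Adj u v → (out u).cluster ≠ (out v).cluster →
    (out u).color ≠ (out v).color
  tree : ∀ v, ∃ T : N.graph.Subgraph,
    T.verts = {u | (out u).cluster = (out v).cluster} ∧
    T.coe.IsTree ∧
    T.coe.ediam ≤ (d : ℕ∞) ∧
    ∀ u ∈ T.verts, ((out u).treeNeighbors : Set ℕ) = N.ident '' T.neighborSet u

/-- The random bits `X i` are uniform and `k`-wise independent: any at most `k` of them are mutually
independent. -/
structure IsKWiseIndepBits {Ω ι : Type} [MeasurableSpace Ω] (μ : Measure Ω) (k : ℕ)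
    (X : ι → Ω → Bool) : Prop where
  measurable : ∀ i, Measurable (X i)
  uniform : ∀ i, μ {ω | X i ω = true} = 1 / 2
  indep : ∀ S : Finset ι, S.card ≤ k → iIndepFun (fun i : S => X i) μ

/-! Randomness is not needed: the deterministic construction of Rozhoň and Ghaffari gives
polylogarithmic parameters. The algorithm reads no random bits, `k = 0` suffices, and the success
probability is `1`.

Let `b` be the number of bits of an identifier. All nodes work on graphs whose vertices are the `2 ^
b` possible identifiers, the unused ones being isolated. To make one color, every unmarked node
starts with its own identifier as label, and the bits are treated one after the other. For bit `i`,
living nodes whose label has bit `0` (blue) propose to adjacent clusters whose label has bit `1`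
(red). A red cluster either accepts, and then grows by a factor of at least `1 + 1 / m`, or rejects,
and then it never has a blue neighbour again and kills less than a fraction `1 / m` of its own size.
After `t` steps with `(1 + 1 / m) ^ t > 2 ^ b` no red node has a blue neighbour
(`growth_of_blue_neighbor`). Charging deaths to settled clusters (`died_le_newly_settled`), each bit
costs at most a fraction `1 / m` of the initial nodes; with `m = 2 * b` half of them survive all `b`
bits. Adjacent survivors then have equal labels, and every label is within `b * t` hops
(`weakClustering_invariant`).

The distances above are measured in the whole graph. Since a label class lies in a small ball, each
of its nodes can see all of it and compute the same carving of it into separated balls of depth at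
most `b` that keep half of the class (`exists_isCarving`). So each color marks a quarter of the
unmarked nodes, and `3 * (b + 1)` colors mark everything.

Every step is a rule of polylogarithmic radius (`IsLocal`), and radii add under composition. Hence a
node that has collected all edges near it can evaluate its own output (`agreeOn_gather`). -/

namespace LocalDecomp

/-! ### Balls in graphs and rules of bounded locality -/

variable {W α β γ : Type*}

/-- The nodes reached from `v` by a walk of length at most `r`. -/
def hopBall (G : SimpleGraph W) (v : W) (r : ℕ) : Set W := {x | ∃ p : G.Walk v x, p.length ≤ r}

lemma mem_hopBall_self (G : SimpleGraph W) (v : W) (r : ℕ) : v ∈ hopBall G v r :=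
  ⟨SimpleGraph.Walk.nil, by simp⟩

lemma hopBall_mono (G : SimpleGraph W) (v : W) {r s : ℕ} (h : r ≤ s) :
    hopBall G v r ⊆ hopBall G v s := fun _ ⟨p, hp⟩ => ⟨p, hp.trans h⟩

lemma mem_hopBall_symm {G : SimpleGraph W} {v x : W} {r : ℕ} (h : x ∈ hopBall G v r) :
    v ∈ hopBall G x r := by
  obtain ⟨p, hp⟩ := h
  exact ⟨p.reverse, by simpa using hp⟩

lemma mem_hopBall_trans {G : SimpleGraph W} {v x y : W} {r s : ℕ} (h : x ∈ hopBall G v r)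
    (h' : y ∈ hopBall G x s) : y ∈ hopBall G v (r + s) := by
  obtain ⟨p, hp⟩ := h
  obtain ⟨q, hq⟩ := h'
  exact ⟨p.append q, by rw [SimpleGraph.Walk.length_append]; omega⟩

lemma mem_hopBall_of_adj {G : SimpleGraph W} {v x : W} (h : G.Adj v x) : x ∈ hopBall G v 1 :=
  ⟨h.toWalk, by simp⟩

/-- The labelled graphs `(G, s)` and `(G', s')` coincide on the ball of radius `r` around `v`,
including the edges that leave the ball. -/
def AgreeOn (r : ℕ) (G G' : SimpleGraph W) (s s' : W → α) (v : W) : Prop :=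
  ∀ x ∈ hopBall G v r, (∀ y, G.Adj x y ↔ G'.Adj x y) ∧ s x = s' x

section AgreeOn

variable {G G' : SimpleGraph W} {s s' : W → α} {v x : W} {q r : ℕ}

lemma AgreeOn.shift (h : AgreeOn (q + r) G G' s s' v) (hx : x ∈ hopBall G v q) :
    AgreeOn r G G' s s' x := fun y hy => h y (mem_hopBall_trans hx hy)

lemma AgreeOn.mono (h : AgreeOn r G G' s s' v) (hq : q ≤ r) : AgreeOn q G G' s s' v :=
  fun y hy => h y (hopBall_mono G v hq hy)

lemma AgreeOn.adj_iff (h : AgreeOn r G G' s s' v) (y : W) : G.Adj v y ↔ G'.Adj v y :=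
  (h v (mem_hopBall_self G v r)).1 y

lemma AgreeOn.label_eq (h : AgreeOn r G G' s s' v) : s v = s' v :=
  (h v (mem_hopBall_self G v r)).2

/-- Adjacency is compared with all nodes, also outside the ball, so a walk can be followed in the
other graph edge by edge, with the radius of agreement shrinking by one each time. -/
lemma AgreeOn.hopBall_subset (h : AgreeOn r G G' s s' v) : hopBall G v r ⊆ hopBall G' v r := by
  rintro x ⟨p, hp⟩
  induction p generalizing r with
  | nil => exact mem_hopBall_self _ _ _
  | @cons u w x hadj p ih =>
    obtain ⟨k, rfl⟩ : ∃ k, r = 1 + k := ⟨r - 1, by simp at hp; omega⟩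
    have := ih (h.shift (mem_hopBall_of_adj hadj)) (by simp at hp; omega)
    exact mem_hopBall_trans (mem_hopBall_of_adj ((h.adj_iff w).1 hadj)) this

lemma AgreeOn.subset_hopBall (h : AgreeOn r G G' s s' v) : hopBall G' v r ⊆ hopBall G v r := by
  rintro x ⟨p, hp⟩
  induction p generalizing r with
  | nil => exact mem_hopBall_self _ _ _
  | @cons u w x hadj p ih =>
    obtain ⟨k, rfl⟩ : ∃ k, r = 1 + k := ⟨r - 1, by simp at hp; omega⟩
    have hadj' := mem_hopBall_of_adj ((h.adj_iff w).2 hadj)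
    exact mem_hopBall_trans hadj' (ih (h.shift hadj') (by simp at hp; omega))

lemma AgreeOn.hopBall_eq (h : AgreeOn r G G' s s' v) : hopBall G v r = hopBall G' v r :=
  h.hopBall_subset.antisymm h.subset_hopBall

end AgreeOn

/-- The new label of a node depends only on its neighbourhood of radius `r`. -/
def IsLocal (r : ℕ) (Φ : SimpleGraph W → (W → α) → W → β) : Prop :=
  ∀ G G' s s' v, AgreeOn r G G' s s' v → Φ G s v = Φ G' s' v

lemma IsLocal.mono {Φ : SimpleGraph W → (W → α) → W → β} {q r : ℕ} (h : IsLocal q Φ)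
    (hq : q ≤ r) : IsLocal r Φ := fun _ _ _ _ _ ha => h _ _ _ _ _ (ha.mono hq)

/-- The outer rule reads intermediate labels at distance at most `q`, and each of them is determined
by a ball of radius `r`. -/
lemma IsLocal.comp {Φ : SimpleGraph W → (W → α) → W → β} {Ψ : SimpleGraph W → (W → β) → W → γ}
    {q r : ℕ} (hΨ : IsLocal q Ψ) (hΦ : IsLocal r Φ) :
    IsLocal (q + r) fun G s => Ψ G (Φ G s) := fun _ _ _ _ _ ha =>
  hΨ _ _ _ _ _ fun _ hx => ⟨(ha.shift hx).adj_iff, hΦ _ _ _ _ _ (ha.shift hx)⟩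

lemma IsLocal.prodMk {Φ : SimpleGraph W → (W → α) → W → β} {Ψ : SimpleGraph W → (W → α) → W → γ}
    {r : ℕ} (hΦ : IsLocal r Φ) (hΨ : IsLocal r Ψ) :
    IsLocal r fun G s v => (Φ G s v, Ψ G s v) := fun _ _ _ _ _ ha =>
  Prod.ext (hΦ _ _ _ _ _ ha) (hΨ _ _ _ _ _ ha)

lemma isLocal_map (f : W → α → β) (r : ℕ) :
    IsLocal r fun (_ : SimpleGraph W) s v => f v (s v) := fun _ _ _ _ _ ha => by
  simp only [ha.label_eq]

/-- The composition of the first `k` maps of a sequence. -/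
def compSeq (Φ : ℕ → SimpleGraph W → (W → α) → W → α) (G : SimpleGraph W) (s : W → α) :
    ℕ → W → α
  | 0 => s
  | k + 1 => Φ k G (compSeq Φ G s k)

lemma IsLocal.compSeq {Φ : ℕ → SimpleGraph W → (W → α) → W → α} {r : ℕ}
    (h : ∀ i, IsLocal r (Φ i)) (k : ℕ) :
    IsLocal (k * r) fun G s => LocalDecomp.compSeq Φ G s k := by
  induction k with
  | zero => exact fun G G' s s' v ha => ha.label_eq
  | succ k ih => exact ((h k).comp ih).mono (by rw [Nat.succ_mul, add_comm])

end LocalDecomp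

namespace LocalDecomp

/-! ### Deterministic weak-diameter clustering -/

section Clustering

variable {W : Type*} (bit : W → ℕ → Bool)

/-- An element of a set, chosen as a function of the set. -/
noncomputable def pick (A : Set W) : Option W :=
  open Classical in if h : A.Nonempty then some h.some else none

lemma mem_of_pick_eq {A : Set W} {x : W} (h : pick A = some x) : x ∈ A := by
  unfold pick at h
  split_ifs at h with hA
  exact Option.some.inj h ▸ hA.some_mem

lemma pick_eq_none_iff {A : Set W} : pick A = none ↔ A = ∅ := by
  unfold pick
  split_ifs with hA
  · simpa using hA.ne_empty
  · simpa using Set.not_nonempty_iff_eq_empty.1 hA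

/-- A blue node is a living one whose label has bit `i` equal to `0`. -/
def IsBlue (i : ℕ) (L : W → Option W) (v : W) : Prop := ∃ l, L v = some l ∧ bit l i = false

/-- The labels with bit `i` equal to `1` of the neighbours of `v`. -/
def redNeighborLabels (i : ℕ) (G : SimpleGraph W) (L : W → Option W) (v : W) : Set W :=
  {l | bit l i = true ∧ ∃ u, G.Adj v u ∧ L u = some l}

/-- The red cluster that the node `v` asks to join. -/
noncomputable def proposal (i : ℕ) (G : SimpleGraph W) (L : W → Option W) (v : W) : Option W :=
  open Classical in if IsBlue bit i L v then pick (redNeighborLabels bit i G L v) else none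

/-- One step of the weak-diameter clustering of Rozhoň and Ghaffari: a red cluster
admits all nodes that propose to it if they are at least a fraction `1 / m` of its size, and
otherwise they die. The sizes are determined within distance `Q`. -/
noncomputable def clusterStep (m Q i : ℕ) (G : SimpleGraph W) (L : W → Option W) (v : W) :
    Option W :=
  open Classical in
  match proposal bit i G L v with
  | none => L v
  | some l =>
    if {x ∈ hopBall G v Q | L x = some l}.ncard ≤
        m * {x ∈ hopBall G v Q | proposal bit i G L x = some l}.ncard then some l else none

/-- A red cluster accepts the nodes that propose to it. -/
def Accepts (m i : ℕ) (G : SimpleGraph W) (L : W → Option W) (l : W) : Prop :=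
  {x | L x = some l}.ncard ≤ m * {x | proposal bit i G L x = some l}.ncard

/-- `clusterStep` with sizes determined in the whole graph. -/
noncomputable def globalStep (m i : ℕ) (G : SimpleGraph W) (L : W → Option W) (v : W) :
    Option W :=
  open Classical in
  match proposal bit i G L v with
  | none => L v
  | some l => if Accepts bit m i G L l then some l else none

/-- Every living node has distance at most `r` from its label. -/
def LabelsWithin (r : ℕ) (G : SimpleGraph W) (L : W → Option W) : Prop :=
  ∀ v l, L v = some l → l ∈ hopBall G v r

/-- Neighbouring living nodes have labels with the same first `i` bits. -/
def BitsAgree (i : ℕ) (G : SimpleGraph W) (L : W → Option W) : Prop :=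
  ∀ u v l k, G.Adj u v → L u = some l → L v = some k → ∀ j < i, bit l j = bit k j

variable {bit} {m Q i r : ℕ} {G : SimpleGraph W} {L : W → Option W} {u v l k : W}

lemma proposal_spec (h : proposal bit i G L v = some l) :
    IsBlue bit i L v ∧ bit l i = true ∧ ∃ u, G.Adj v u ∧ L u = some l := by
  unfold proposal at h
  split_ifs at h with hb
  exact ⟨hb, mem_of_pick_eq (A := redNeighborLabels bit i G L v) h⟩

lemma proposal_ne_none (hv : IsBlue bit i L v) (huv : G.Adj v u) (hu : L u = some l)
    (hl : bit l i = true) : proposal bit i G L v ≠ none := by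
  unfold proposal
  rw [if_pos hv, Ne, pick_eq_none_iff, ← Ne, ← Set.nonempty_iff_ne_empty]
  exact ⟨l, hl, u, huv, hu⟩

lemma globalStep_of_none (h : proposal bit i G L v = none) : globalStep bit m i G L v = L v := by
  simp [globalStep, h]

lemma globalStep_of_accepts (h : proposal bit i G L v = some l) (ha : Accepts bit m i G L l) :
    globalStep bit m i G L v = some l := by
  simp [globalStep, h, ha]

lemma globalStep_of_not_accepts (h : proposal bit i G L v = some l)
    (ha : ¬ Accepts bit m i G L l) : globalStep bit m i G L v = none := by
  simp [globalStep, h, ha]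

lemma globalStep_eq_some (h : globalStep bit m i G L v = some l) :
    (proposal bit i G L v = none ∧ L v = some l) ∨
      (proposal bit i G L v = some l ∧ Accepts bit m i G L l) := by
  rcases hp : proposal bit i G L v with _ | k
  · exact .inl ⟨rfl, by rwa [globalStep_of_none hp] at h⟩
  · by_cases ha : Accepts bit m i G L k
    · rw [globalStep_of_accepts hp ha] at h
      obtain rfl := Option.some.inj h
      exact .inr ⟨rfl, ha⟩
    · rw [globalStep_of_not_accepts hp ha] at h
      cases h

lemma proposal_of_red (h : L v = some l) (hl : bit l i = true) : proposal bit i G L v = none := by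
  by_contra hne
  obtain ⟨k, hk⟩ := Option.ne_none_iff_exists'.1 hne
  obtain ⟨⟨l', hl', hb⟩, -⟩ := proposal_spec hk
  simp_all

lemma globalStep_of_red (h : L v = some l) (hl : bit l i = true) :
    globalStep bit m i G L v = some l := by
  rw [globalStep_of_none (proposal_of_red h hl), h]

lemma globalStep_eq_some_blue (h : globalStep bit m i G L v = some l) (hl : bit l i = false) :
    proposal bit i G L v = none ∧ L v = some l := by
  rcases globalStep_eq_some h with h | ⟨h, -⟩
  · exact h
  · have := (proposal_spec h).2.1
    simp_all

lemma globalStep_of_dead (h : L v = none) : globalStep bit m i G L v = none := by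
  rw [globalStep_of_none, h]
  by_contra hne
  obtain ⟨k, hk⟩ := Option.ne_none_iff_exists'.1 hne
  obtain ⟨⟨l', hl', -⟩, -⟩ := proposal_spec hk
  simp_all

lemma LabelsWithin.globalStep (h : LabelsWithin r G L) :
    LabelsWithin (r + 1) G (globalStep bit m i G L) := by
  intro v l hl
  rcases globalStep_eq_some hl with ⟨-, h'⟩ | ⟨h', -⟩
  · exact hopBall_mono _ _ (Nat.le_succ r) (h v l h')
  · obtain ⟨-, -, u, hu, hl'⟩ := proposal_spec h'
    rw [add_comm]
    exact mem_hopBall_trans (mem_hopBall_of_adj hu) (h u l hl')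

/-- Members of a cluster and nodes proposing to it are within `r + 1` of its label, hence within `2
* r + 2` of each other. Thus the analysis can use `globalStep`, while `clusterStep` is visibly
local. -/
lemma clusterStep_eq_globalStep (h : LabelsWithin r G L) (hQ : 2 * r + 2 ≤ Q) :
    clusterStep bit m Q i G L = globalStep bit m i G L := by
  funext v
  rcases hp : proposal bit i G L v with _ | l
  · simp [clusterStep, globalStep, hp]
  · obtain ⟨-, -, u, hu, hl⟩ := proposal_spec hp
    have hv : l ∈ hopBall G v (1 + r) := mem_hopBall_trans (mem_hopBall_of_adj hu) (h u l hl)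
    have h1 : {x | x ∈ hopBall G v Q ∧ L x = some l} = {x | L x = some l} := by
      ext x
      refine ⟨fun hx => hx.2, fun hx => ⟨?_, hx⟩⟩
      exact hopBall_mono _ _ (by omega) (mem_hopBall_trans hv (mem_hopBall_symm (h x l hx)))
    have h2 : {x | x ∈ hopBall G v Q ∧ proposal bit i G L x = some l} =
        {x | proposal bit i G L x = some l} := by
      ext x
      refine ⟨fun hx => hx.2, fun hx => ⟨?_, hx⟩⟩
      obtain ⟨-, -, w, hw, hl'⟩ := proposal_spec hx
      have := mem_hopBall_trans (mem_hopBall_of_adj hw) (h w l hl')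
      exact hopBall_mono _ _ (by omega) (mem_hopBall_trans hv (mem_hopBall_symm this))
    simp only [clusterStep, globalStep, hp, h1, h2, Accepts]
    congr

/-- A node changes its label only to that of a living neighbour, which has the same first `n` bits.
-/
lemma BitsAgree.globalStep {n : ℕ} (hi : BitsAgree bit n G L) :
    BitsAgree bit n G (globalStep bit m i G L) := by
  have key : ∀ v l, LocalDecomp.globalStep bit m i G L v = some l →
      ∃ k, L v = some k ∧ ∀ j < n, bit l j = bit k j := by
    intro v l hl
    rcases globalStep_eq_some hl with ⟨-, h⟩ | ⟨h, -⟩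
    · exact ⟨l, h, fun _ _ => rfl⟩
    · obtain ⟨⟨k, hk, -⟩, -, u, hu, hl'⟩ := proposal_spec h
      exact ⟨k, hk, hi u v l k hu.symm hl' hk⟩
  intro u v l k huv hu hv j hj
  obtain ⟨l', hl', h1⟩ := key u l hu
  obtain ⟨k', hk', h2⟩ := key v k hv
  rw [h1 j hj, h2 j hj, hi u v l' k' huv hl' hk' j hj]

lemma size_add_proposals_le [Finite W] (hl : bit l i = true) (ha : Accepts bit m i G L l) :
    {x | L x = some l}.ncard + {x | proposal bit i G L x = some l}.ncard ≤
      {x | globalStep bit m i G L x = some l}.ncard := by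
  rw [← Set.ncard_union_eq]
  · refine Set.ncard_le_ncard ?_
    rintro x (hx | hx)
    · exact globalStep_of_red hx hl
    · exact globalStep_of_accepts hx ha
  · rw [Set.disjoint_left]
    intro x hx hx'
    have := proposal_of_red (G := G) hx hl
    simp_all

/-- A red cluster that still has a blue neighbour after `t` steps has grown in every step. -/
lemma growth_of_blue_neighbor [Finite W] (t : ℕ) :
    ∀ u v l, G.Adj v u → IsBlue bit i ((globalStep bit m i G)^[t] L) v →
      (globalStep bit m i G)^[t] L u = some l → bit l i = true →
      (m + 1) ^ t ≤ m ^ t * {x | (globalStep bit m i G)^[t] L x = some l}.ncard := by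
  induction t with
  | zero =>
    intro u v l _ _ hu _
    simp only [pow_zero, one_mul]
    exact (Set.ncard_pos).2 ⟨u, hu⟩
  | succ t ih =>
    intro u v l huv hv hu hl
    rw [Function.iterate_succ_apply'] at hv hu ⊢
    set L' := (globalStep bit m i G)^[t] L
    obtain ⟨k, hk, hkb⟩ := hv
    -- A node that is blue after a step was blue before it and made no proposal; so it had no
    -- neighbour in a red cluster.
    obtain ⟨hpv, hk'⟩ := globalStep_eq_some_blue hk hkb
    have hvb : IsBlue bit i L' v := ⟨k, hk', hkb⟩
    rcases globalStep_eq_some hu with ⟨-, hu'⟩ | ⟨hu', ha⟩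
    · exact absurd hpv (proposal_ne_none hvb huv hu' hl)
    · obtain ⟨hub, -, w, hw, hwl⟩ := proposal_spec hu'
      have h1 := ih w u l hw hub hwl hl
      have h2 := size_add_proposals_le (m := m) hl ha
      unfold Accepts at ha
      set A := {x | L' x = some l}.ncard
      set P := {x | proposal bit i G L' x = some l}.ncard
      calc (m + 1) ^ (t + 1) = (m + 1) ^ t * (m + 1) := pow_succ _ _
        _ ≤ m ^ t * A * (m + 1) := by gcongr
        _ = m ^ t * (m * A + A) := by ring
        _ ≤ m ^ t * (m * A + m * P) := by gcongr
        _ = m ^ (t + 1) * (A + P) := by ring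
        _ ≤ _ := by gcongr

/-- The nodes of the red clusters without blue neighbours. -/
def settled (bit : W → ℕ → Bool) (i : ℕ) (G : SimpleGraph W) (L : W → Option W) : Set W :=
  {x | ∃ l, L x = some l ∧ bit l i = true ∧
    ∀ u v, L u = some l → G.Adj v u → ¬ IsBlue bit i L v}

lemma isBlue_of_globalStep (h : IsBlue bit i (globalStep bit m i G L) v) : IsBlue bit i L v := by
  obtain ⟨k, hk, hkb⟩ := h
  exact ⟨k, (globalStep_eq_some_blue hk hkb).2, hkb⟩

/-- No new blue nodes arise, and a cluster without blue neighbours receives no proposals. -/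
lemma settled_subset_globalStep :
    settled bit i G L ⊆ settled bit i G (globalStep bit m i G L) := by
  rintro x ⟨l, hx, hl, hs⟩
  refine ⟨l, globalStep_of_red hx hl, hl, fun u v hu huv hv => ?_⟩
  rcases globalStep_eq_some hu with ⟨-, hu'⟩ | ⟨hu', -⟩
  · exact hs u v hu' huv (isBlue_of_globalStep hv)
  · obtain ⟨hub, -, w, hw, hwl⟩ := proposal_spec hu'
    exact hs w u hwl hw hub

/-- Every blue neighbour of the cluster proposed somewhere, so it dies or becomes red; and a cluster
that rejects gains no nodes that could bring new blue neighbours. -/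
lemma mem_settled_of_not_accepts (hl : bit l i = true) (ha : ¬ Accepts bit m i G L l)
    (hx : L v = some l) : v ∈ settled bit i G (globalStep bit m i G L) := by
  refine ⟨l, globalStep_of_red hx hl, hl, fun u w hu huw ⟨k, hk, hkb⟩ => ?_⟩
  obtain ⟨hpw, hk'⟩ := globalStep_eq_some_blue hk hkb
  rcases globalStep_eq_some hu with ⟨-, hu'⟩ | ⟨-, ha'⟩
  · exact proposal_ne_none ⟨k, hk', hkb⟩ huw hu' hl hpw
  · exact ha ha'

/-- The nodes that die in a step are charged to the clusters that become settled in it. -/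
lemma died_le_newly_settled [Finite W] :
    m * {x | L x ≠ none ∧ globalStep bit m i G L x = none}.ncard ≤
      (settled bit i G (globalStep bit m i G L) \ settled bit i G L).ncard := by
  classical
  have := Fintype.ofFinite W
  rw [Set.ncard_eq_toFinset_card', Set.ncard_eq_toFinset_card']
  set K := {x | L x ≠ none ∧ globalStep bit m i G L x = none}.toFinset
  set F := (settled bit i G (globalStep bit m i G L) \ settled bit i G L).toFinset
  -- Nodes that die are grouped by the cluster that rejected them, newly settled nodes by their own
  -- cluster.
  rw [Finset.card_eq_sum_card_fiberwise (s := K) (t := Finset.univ)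
      (f := fun x => proposal bit i G L x) (by simp),
    Finset.card_eq_sum_card_fiberwise (s := F) (t := Finset.univ) (f := fun x => L x) (by simp),
    Finset.mul_sum]
  refine Finset.sum_le_sum fun o _ => ?_
  rcases (K.filter fun x => proposal bit i G L x = o).eq_empty_or_nonempty with he | ⟨x, hx⟩
  · simp [he]
  simp only [K, Finset.mem_filter, Set.mem_toFinset, Set.mem_ofPred_eq] at hx
  obtain ⟨⟨hx1, hx2⟩, rfl⟩ := hx
  rcases hp : proposal bit i G L x with _ | l
  · rw [globalStep_of_none hp] at hx2
    exact absurd hx2 hx1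
  have ha : ¬ Accepts bit m i G L l := fun ha => by
    rw [globalStep_of_accepts hp ha] at hx2
    cases hx2
  obtain ⟨hb, hl, u, hu, hul⟩ := proposal_spec hp
  have h1 : (K.filter fun y => proposal bit i G L y = some l).card ≤
      {y | proposal bit i G L y = some l}.ncard := by
    rw [Set.ncard_eq_toFinset_card']
    exact Finset.card_le_card fun y hy => by simpa using (Finset.mem_filter.1 hy).2
  have h2 : {y | L y = some l}.ncard ≤ (F.filter fun y => L y = some l).card := by
    rw [Set.ncard_eq_toFinset_card']
    refine Finset.card_le_card fun y hy => ?_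
    have hy' : L y = some l := by simpa using hy
    simp only [F, Finset.mem_filter, Set.mem_toFinset, Set.mem_sdiff]
    refine ⟨⟨mem_settled_of_not_accepts hl ha hy', ?_⟩, hy'⟩
    -- The cluster was not settled before the step, since the blue node `x` was adjacent to it.
    rintro ⟨l', hyl, -, hs⟩
    obtain rfl : l = l' := Option.some.inj (hy'.symm.trans hyl)
    exact hs u x hul hu hb
  unfold Accepts at ha
  calc _ ≤ m * {y | proposal bit i G L y = some l}.ncard := by gcongr
    _ ≤ _ := (not_le.1 ha).le.trans h2

/-- The potential `m * alive + settled` never decreases, so the deaths over all steps for one bit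
are bounded by the final number of settled nodes divided by `m`. -/
lemma alive_add_settled_le [Finite W] (t : ℕ) :
    m * {x | L x ≠ none}.ncard + (settled bit i G L).ncard ≤
      m * {x | (globalStep bit m i G)^[t] L x ≠ none}.ncard +
        (settled bit i G ((globalStep bit m i G)^[t] L)).ncard := by
  induction t with
  | zero => rfl
  | succ t ih =>
    refine ih.trans ?_
    rw [Function.iterate_succ_apply']
    set L' := (globalStep bit m i G)^[t] L
    have h1 := died_le_newly_settled (bit := bit) (m := m) (i := i) (G := G) (L := L')
    have h2 := Set.ncard_sdiff_add_ncard_of_subset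
      (settled_subset_globalStep (bit := bit) (m := m) (i := i) (G := G) (L := L'))
    have h3 : {x | L' x ≠ none}.ncard ≤ {x | globalStep bit m i G L' x ≠ none}.ncard +
        {x | L' x ≠ none ∧ globalStep bit m i G L' x = none}.ncard := by
      refine (Set.ncard_le_ncard ?_).trans (Set.ncard_union_le _ _)
      intro x hx
      by_cases h : globalStep bit m i G L' x = none
      · exact .inr ⟨hx, h⟩
      · exact .inl h
    have h4 := Nat.mul_le_mul_left m h3
    rw [Nat.mul_add] at h4
    omega

/-- The alive nodes after any number of steps were alive before. -/
lemma ne_none_of_iterate (t : ℕ) (h : (globalStep bit m i G)^[t] L v ≠ none) : L v ≠ none := by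
  induction t with
  | zero => exact h
  | succ t ih =>
    rw [Function.iterate_succ_apply'] at h
    exact ih fun h' => h (globalStep_of_dead h')

lemma LabelsWithin.iterate (h : LabelsWithin r G L) (t : ℕ) :
    LabelsWithin (r + t) G ((LocalDecomp.globalStep bit m i G)^[t] L) := by
  induction t with
  | zero => exact h
  | succ t ih =>
    rw [Function.iterate_succ_apply']
    exact ih.globalStep

lemma BitsAgree.iterate {n : ℕ} (hi : BitsAgree bit n G L) (t : ℕ) :
    BitsAgree bit n G ((LocalDecomp.globalStep bit m i G)^[t] L) := by
  induction t with
  | zero => exact hi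
  | succ t ih =>
    rw [Function.iterate_succ_apply']
    exact ih.globalStep

lemma compSeq_clusterStep (h : LabelsWithin r G L) (t : ℕ) (hQ : 2 * (r + t) ≤ Q) :
    compSeq (fun _ => clusterStep bit m Q i) G L t = (globalStep bit m i G)^[t] L := by
  induction t with
  | zero => rfl
  | succ t ih =>
    rw [compSeq, ih (by omega), Function.iterate_succ_apply',
      clusterStep_eq_globalStep (h.iterate t) (by omega)]

/-- After sufficiently many steps no red node has a blue neighbour. -/
lemma BitsAgree.succ_iterate [Finite W] (hi : BitsAgree bit i G L) {t : ℕ}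
    (ht : m ^ t * Nat.card W < (m + 1) ^ t) :
    BitsAgree bit (i + 1) G ((LocalDecomp.globalStep bit m i G)^[t] L) := by
  have hi' := hi.iterate t (m := m) (i := i)
  have key : ∀ u v l, G.Adj v u → IsBlue bit i ((LocalDecomp.globalStep bit m i G)^[t] L) v →
      (LocalDecomp.globalStep bit m i G)^[t] L u = some l → bit l i ≠ true := by
    intro u v l huv hv hu hl
    have h1 := growth_of_blue_neighbor t u v l huv hv hu hl
    have h2 : {x | (LocalDecomp.globalStep bit m i G)^[t] L x = some l}.ncard ≤ Nat.card W :=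
      Set.ncard_le_card _
    have h3 := Nat.mul_le_mul_left (m ^ t) h2
    omega
  intro u v l k huv hu hv j hj
  rcases Nat.lt_succ_iff_lt_or_eq.1 hj with hj | rfl
  · exact hi' u v l k huv hu hv j hj
  · rcases hl : bit l j <;> rcases hk : bit k j
    · rfl
    · exact absurd hk (key v u k huv ⟨l, hu, hl⟩ hv)
    · exact absurd hl (key u v l huv.symm ⟨k, hv, hk⟩ hu)
    · rfl

/-- The weak-diameter clustering: for each bit, `t` steps. -/
noncomputable def weakClustering (bit : W → ℕ → Bool) (m Q t b : ℕ) (G : SimpleGraph W)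
    (L : W → Option W) : W → Option W :=
  compSeq (fun i G L => compSeq (fun _ => clusterStep bit m Q i) G L t) G L b

/-- Each step lengthens the distance to the labels by at most one. Each bit decreases `m * alive` by
at most the number of settled nodes, which were all alive at the start. -/
lemma weakClustering_invariant [Finite W] {t : ℕ} (ht : m ^ t * Nat.card W < (m + 1) ^ t)
    (h0 : LabelsWithin 0 G L) (b : ℕ) (hQ : 2 * (b * t) ≤ Q) :
    LabelsWithin (b * t) G (weakClustering bit m Q t b G L) ∧
    BitsAgree bit b G (weakClustering bit m Q t b G L) ∧
    (∀ v, weakClustering bit m Q t b G L v ≠ none → L v ≠ none) ∧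
    m * {x | L x ≠ none}.ncard ≤ m * {x | weakClustering bit m Q t b G L x ≠ none}.ncard +
      b * {x | L x ≠ none}.ncard := by
  induction b with
  | zero =>
    refine ⟨by simpa [weakClustering, compSeq] using h0, fun _ _ _ _ _ _ _ j hj => by omega,
      fun _ h => h, by simp [weakClustering, compSeq]⟩
  | succ b ih =>
    have hbt : (b + 1) * t = b * t + t := by ring
    rw [hbt] at hQ ⊢
    obtain ⟨h1, h2, h3, h4⟩ := ih (by omega)
    have e : weakClustering bit m Q t (b + 1) G L =
        (globalStep bit m b G)^[t] (weakClustering bit m Q t b G L) :=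
      compSeq_clusterStep h1 t (by omega)
    rw [e]
    set L' := weakClustering bit m Q t b G L
    refine ⟨?_, h2.succ_iterate ht, fun v hv => h3 v (ne_none_of_iterate t hv), ?_⟩
    · exact h1.iterate t
    · have h5 := alive_add_settled_le (bit := bit) (m := m) (i := b) (G := G) (L := L') t
      have h6 : (settled bit b G ((globalStep bit m b G)^[t] L')).ncard ≤
          {x | L x ≠ none}.ncard := by
        refine Set.ncard_le_ncard ?_
        rintro x ⟨l, hx, -⟩
        exact h3 x (ne_none_of_iterate (m := m) (i := b) (G := G) (bit := bit) t (by simp [hx]))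
      rw [add_one_mul]
      omega

end Clustering

/-! ### Locality of the weak-diameter clustering -/

section ClusteringLocal

variable {W : Type*} {bit : W → ℕ → Bool}

lemma isLocal_proposal (i : ℕ) : IsLocal 1 (proposal bit i) := by
  intro G G' s s' v ha
  have h1 : IsBlue bit i s v = IsBlue bit i s' v := by simp only [IsBlue, ha.label_eq]
  have h2 : redNeighborLabels bit i G s v = redNeighborLabels bit i G' s' v := by
    ext l
    refine and_congr_right fun _ => exists_congr fun u => ?_
    rw [← ha.adj_iff u]
    refine and_congr_right fun hu => ?_
    rw [(ha u (mem_hopBall_of_adj hu)).2]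
  simp only [proposal, h2]
  congr

lemma isLocal_clusterStep (m Q i : ℕ) : IsLocal (Q + 1) (clusterStep bit m Q i) := by
  intro G G' s s' v ha
  have hP := isLocal_proposal (bit := bit) i
  have hb : hopBall G v Q = hopBall G' v Q := (ha.mono (Nat.le_succ Q)).hopBall_eq
  have h0 : proposal bit i G s v = proposal bit i G' s' v := hP _ _ _ _ _ (ha.mono (by omega))
  have h1 : ∀ l, {x | x ∈ hopBall G v Q ∧ s x = some l} =
      {x | x ∈ hopBall G' v Q ∧ s' x = some l} := by
    intro l
    ext x
    simp only [← hb]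
    exact and_congr_right fun hx => by rw [(ha.mono (Nat.le_succ Q) x hx).2]
  have h2 : ∀ l, {x | x ∈ hopBall G v Q ∧ proposal bit i G s x = some l} =
      {x | x ∈ hopBall G' v Q ∧ proposal bit i G' s' x = some l} := by
    intro l
    ext x
    simp only [← hb]
    exact and_congr_right fun hx => by rw [hP _ _ _ _ _ (ha.shift hx)]
  simp only [clusterStep, h0, h1, h2, ha.label_eq]

lemma isLocal_weakClustering (m Q t b : ℕ) :
    IsLocal (b * (t * (Q + 1))) (weakClustering bit m Q t b) :=
  IsLocal.compSeq (fun i => IsLocal.compSeq (fun _ => isLocal_clusterStep m Q i) t) b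

end ClusteringLocal

end LocalDecomp

namespace LocalDecomp

/-! ### Ball carving with strong diameter -/

section Carving

variable {W : Type*}

/-- The graph with the edges of `G` inside `S`. -/
def restrict (G : SimpleGraph W) (S : Set W) : SimpleGraph W where
  Adj x y := G.Adj x y ∧ x ∈ S ∧ y ∈ S
  symm := ⟨fun _ _ h => ⟨h.1.symm, h.2.2, h.2.1⟩⟩
  loopless := ⟨fun _ h => h.1.ne rfl⟩

/-- The partial map `f` describes clusters that contain at least half of the nodes of `S`: `f v`
consists of the center of the cluster of `v` and a neighbour of `v` in this cluster that is closer to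
the center. There are no edges between different clusters. -/
structure IsCarving (G : SimpleGraph W) (S : Set W) (d : ℕ) (f : W → Option (W × W)) : Prop where
  mem : ∀ v, f v ≠ none → v ∈ S
  half : S.ncard ≤ 2 * {v | f v ≠ none}.ncard
  center : ∀ v z p, f v = some (z, p) → ∃ q, f z = some (z, q)
  parent : ∃ depth : W → ℕ, ∀ v z p, f v = some (z, p) → depth v ≤ d ∧
    (v = z ∨ G.Adj v p ∧ depth p < depth v ∧ ∃ q, f p = some (z, q))
  separated : ∀ u v x y, G.Adj u v → f u = some x → f v = some y → x.1 = y.1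

lemma hopBall_restrict_subset {G : SimpleGraph W} {S : Set W} {v : W} (hv : v ∈ S) (r : ℕ) :
    hopBall (restrict G S) v r ⊆ S := by
  rintro x ⟨p, -⟩
  induction p with
  | nil => exact hv
  | cons h _ ih => exact ih h.2.2

lemma exists_adj_of_mem_hopBall_succ {G : SimpleGraph W} {v x : W} {r : ℕ}
    (h : x ∈ hopBall G v (r + 1)) : x = v ∨ ∃ w ∈ hopBall G v r, G.Adj x w := by
  obtain ⟨p, hp⟩ := mem_hopBall_symm h
  cases p with
  | nil => exact .inl rfl
  | cons hadj q => exact .inr ⟨_, mem_hopBall_symm ⟨q, by simpa using hp⟩, hadj⟩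

/-- Balls cannot double their size in each of many consecutive steps. -/
lemma exists_ball_slow_growth [Finite W] (G : SimpleGraph W) (v : W) {d : ℕ}
    (hd : Nat.card W ≤ 2 ^ d) :
    ∃ r ≤ d, (hopBall G v (r + 1)).ncard ≤ 2 * (hopBall G v r).ncard := by
  by_contra! h
  have key : ∀ r ≤ d + 1, 2 ^ r ≤ (hopBall G v r).ncard := by
    intro r
    induction r with
    | zero => exact fun _ => (Set.ncard_pos).2 ⟨v, mem_hopBall_self G v 0⟩
    | succ r ih =>
      intro hr
      have := ih (by omega)
      have := h r (by omega)
      rw [pow_succ]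
      omega
  have h1 := key (d + 1) le_rfl
  have h2 : (hopBall G v (d + 1)).ncard ≤ Nat.card W := Set.ncard_le_card _
  have h3 : 2 ^ d < 2 ^ (d + 1) := Nat.pow_lt_pow_right (by norm_num) (Nat.lt_succ_self d)
  omega

/-- Around any `v ∈ S` there is a ball of radius `r ≤ d` in the graph induced on `S` whose next ball
is at most twice as large. It becomes a cluster, the sphere around it is dropped, and the rest of
`S` is carved recursively. Dropping the sphere separates the clusters and costs no more nodes than
the ball contains. -/
lemma exists_isCarving [Finite W] (G : SimpleGraph W) {d : ℕ} (hd : Nat.card W ≤ 2 ^ d)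
    (S : Set W) : ∃ f, IsCarving G S d f := by
  classical
  induction hn : S.ncard using Nat.strong_induction_on generalizing S with
  | _ n ih =>
    rcases S.eq_empty_or_nonempty with rfl | ⟨v, hv⟩
    · exact ⟨fun _ => none, ⟨by simp, by simp, by simp, ⟨fun _ => 0, by simp⟩, by simp⟩⟩
    obtain ⟨r, hr, hgrow⟩ := exists_ball_slow_growth (restrict G S) v hd
    set B := hopBall (restrict G S) v with hB
    have hBS : ∀ k, B k ⊆ S := hopBall_restrict_subset hv
    have hvB : ∀ k, v ∈ B k := mem_hopBall_self _ _
    have hsum := Set.ncard_sdiff_add_ncard_of_subset (hBS (r + 1))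
    have hpos : 0 < (B (r + 1)).ncard := (Set.ncard_pos).2 ⟨v, hvB _⟩
    obtain ⟨f, hf⟩ := ih _ (by omega) (S \ B (r + 1)) rfl
    obtain ⟨depth, hdepth⟩ := hf.parent
    have hdisj : ∀ x ∈ B r, f x = none := by
      intro x hx
      by_contra hne
      exact (hf.mem x hne).2 (hopBall_mono _ _ (Nat.le_succ r) hx)
    -- The distance from `v` in the graph induced on `S`; a parent is a neighbour at smaller
    -- distance.
    let dep : W → ℕ := fun x => sInf {k | x ∈ B k}
    have hdep : ∀ x ∈ B r, x ∈ B (dep x) := fun x hx => Nat.sInf_mem (s := {k | x ∈ B k}) ⟨r, hx⟩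
    have hpar : ∀ x, ∃ p, x ∈ B r → x = v ∨ G.Adj x p ∧ dep p < dep x ∧ p ∈ B r := by
      intro x
      by_cases hx : x ∈ B r
      · have h1 := hdep x hx
        have h2 : dep x ≤ r := Nat.sInf_le hx
        rcases hk : dep x with _ | k
        · rw [hk] at h1
          obtain ⟨p, hp⟩ := h1
          exact ⟨v, fun _ => .inl (SimpleGraph.Walk.eq_of_length_eq_zero (by omega : p.length = 0)).symm⟩
        · rw [hk] at h1 h2
          rcases exists_adj_of_mem_hopBall_succ h1 with h | ⟨w, hw, hadj⟩
          · exact ⟨v, fun _ => .inl h⟩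
          · have h3 : dep w ≤ k := Nat.sInf_le hw
            exact ⟨w, fun _ => .inr ⟨hadj.1, by omega, hopBall_mono _ _ (by omega) hw⟩⟩
      · exact ⟨v, fun h => absurd h hx⟩
    choose par hpar using hpar
    let g : W → Option (W × W) := fun x => if x ∈ B r then some (v, par x) else f x
    have g1 : ∀ x ∈ B r, g x = some (v, par x) := fun x hx => if_pos hx
    have g2 : ∀ x, x ∉ B r → g x = f x := fun x hx => if_neg hx
    have g3 : ∀ x y, f x = some y → x ∉ B r ∧ g x = some y := by
      intro x y hxy
      have : x ∉ B r := fun h => by simp [hdisj x h] at hxy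
      exact ⟨this, (g2 x this).trans hxy⟩
    refine ⟨g, ⟨?_, ?_, ?_, ⟨fun x => if x ∈ B r then dep x else depth x, ?_⟩, ?_⟩⟩
    · intro x hx
      by_cases h : x ∈ B r
      · exact hBS r h
      · exact (hf.mem x (g2 x h ▸ hx)).1
    · have e : {x | g x ≠ none} = {x | f x ≠ none} ∪ B r := by
        ext x
        by_cases h : x ∈ B r
        · simp [h, g1 x h]
        · simp [h, g2 x h]
      rw [e, Set.ncard_union_eq]
      · have := hf.half
        omega
      · rw [Set.disjoint_left]
        exact fun x hx hx' => hx (hdisj x hx')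
    · intro x z p hx
      by_cases h : x ∈ B r
      · rw [g1 x h] at hx
        obtain ⟨rfl, -⟩ := Prod.mk.inj (Option.some.inj hx)
        exact ⟨par v, g1 v (hvB r)⟩
      · rw [g2 x h] at hx
        obtain ⟨q, hq⟩ := hf.center x z p hx
        exact ⟨q, (g3 _ _ hq).2⟩
    · intro x z p hx
      by_cases h : x ∈ B r
      · rw [g1 x h] at hx
        obtain ⟨rfl, rfl⟩ := Prod.mk.inj (Option.some.inj hx)
        simp only [if_pos h]
        refine ⟨(Nat.sInf_le h : dep x ≤ r).trans hr, (hpar x h).imp id ?_⟩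
        rintro ⟨h1, h2, h3⟩
        exact ⟨h1, by rwa [if_pos h3], par (par x), g1 _ h3⟩
      · rw [g2 x h] at hx
        simp only [if_neg h]
        obtain ⟨h1, h2⟩ := hdepth x z p hx
        refine ⟨h1, h2.imp id ?_⟩
        rintro ⟨h3, h4, q, hq⟩
        obtain ⟨h5, h6⟩ := g3 _ _ hq
        exact ⟨h3, by rwa [if_neg h5], q, h6⟩
    · have key : ∀ x y b, G.Adj x y → x ∈ B r → y ∉ B r → g y ≠ some b := by
        intro x y b hxy hx hy hgy
        rw [g2 y hy] at hgy
        have := hf.mem y (by simp [hgy])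
        refine this.2 (mem_hopBall_trans hx (mem_hopBall_of_adj ?_))
        exact ⟨hxy, hBS r hx, this.1⟩
      intro x y a b hxy hx hy
      by_cases h : x ∈ B r <;> by_cases h' : y ∈ B r
      · rw [g1 x h] at hx
        rw [g1 y h'] at hy
        rw [← Option.some.inj hx, ← Option.some.inj hy]
      · exact absurd hy (key x y b hxy h h')
      · exact absurd hx (key y x a hxy.symm h' h)
      · rw [g2 x h] at hx
        rw [g2 y h'] at hy
        exact hf.separated x y a b hxy hx hy

/-- A carving of `C`, chosen as a function of the graph and of `C`. -/
noncomputable def carve (d : ℕ) (G : SimpleGraph W) (C : Set W) : W → Option (W × W) :=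
  open Classical in
  if h : ∃ f, IsCarving G C d f then h.choose else fun _ => none

lemma isCarving_carve [Finite W] {d : ℕ} (hd : Nat.card W ≤ 2 ^ d) (G : SimpleGraph W)
    (C : Set W) : IsCarving G C d (carve d G C) := by
  have h := exists_isCarving G hd C
  rw [carve, dif_pos h]
  exact h.choose_spec

end Carving

end LocalDecomp

/-! ### Coloring: repeated clustering and carving of the unmarked nodes -/

namespace LocalDecomp

/-- What a node knows about its cluster. -/
@[ext] structure ClusterMark (W : Type*) where
  color : ℕ
  center : W
  parent : W

section Coloring

variable {W : Type*}

/-- The marked nodes form properly colored clusters with trees of depth at most `d`, given by the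
pointers to the parents. -/
structure IsMarking (G : SimpleGraph W) (d c : ℕ) (st : W → Option (ClusterMark W)) : Prop where
  color_mem : ∀ v x, st v = some x → 1 ≤ x.color ∧ x.color ≤ c
  center : ∀ v x, st v = some x →
    ∃ y, st x.center = some y ∧ y.center = x.center ∧ y.color = x.color
  parent : ∃ depth : W → ℕ, ∀ v x, st v = some x → depth v ≤ d ∧
    (v = x.center ∨ G.Adj v x.parent ∧ depth x.parent < depth v ∧
      ∃ y, st x.parent = some y ∧ y.center = x.center)
  separated : ∀ u v x y, G.Adj u v → st u = some x → st v = some y → x.center ≠ y.center →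
    x.color ≠ y.color

variable (bit : W → ℕ → Bool) (m Q t b d : ℕ)

/-- The unmarked nodes, each of them labelled by itself. -/
noncomputable def unmarked (st : W → Option (ClusterMark W)) (v : W) : Option W :=
  match st v with
  | none => some v
  | some _ => none

/-- Given the labels of a weak-diameter clustering of the unmarked nodes, each cluster is carved into
clusters of small strong diameter, which get the color `i + 1`. -/
noncomputable def markClusters (i : ℕ) (G : SimpleGraph W)
    (s : W → Option (ClusterMark W) × Option W) (v : W) : Option (ClusterMark W) :=
  match s v with
  | (some x, _) => some x
  | (none, none) => none
  | (none, some l) =>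
    (carve d (restrict G {x | x ∈ hopBall G v Q ∧ (s x).2 = some l})
      {x | x ∈ hopBall G v Q ∧ (s x).2 = some l} v).map fun z => ⟨i + 1, z.1, z.2⟩

/-- One color of the decomposition. -/
noncomputable def colorStep (i : ℕ) (G : SimpleGraph W) (st : W → Option (ClusterMark W)) :
    W → Option (ClusterMark W) :=
  markClusters Q d i G fun v => (st v, weakClustering bit m Q t b G (unmarked st) v)

/-- `carve` makes a choice that depends on the whole graph given to it. Restricting the graph to the
label class makes this argument a function of the ball of radius `Q`. -/
lemma isLocal_markClusters (i : ℕ) : IsLocal (W := W) Q (markClusters Q d i) := by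
  intro G G' s s' v ha
  have hb := ha.hopBall_eq
  have h1 : ∀ l, {x | x ∈ hopBall G v Q ∧ (s x).2 = some l} =
      {x | x ∈ hopBall G' v Q ∧ (s' x).2 = some l} := by
    intro l
    ext x
    simp only [← hb]
    exact and_congr_right fun hx => by rw [(ha x hx).2]
  have h2 : ∀ l, restrict G {x | x ∈ hopBall G' v Q ∧ (s' x).2 = some l} =
      restrict G' {x | x ∈ hopBall G' v Q ∧ (s' x).2 = some l} := by
    intro l
    rw [← h1 l]
    ext x y
    exact and_congr_left fun hxy => (ha x hxy.1.1).1 y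
  unfold markClusters
  rw [ha.label_eq]
  rcases s' v with ⟨_ | x, _ | l⟩
  · rfl
  · simp only [h1, h2]
  · rfl
  · rfl

lemma isLocal_colorStep (i : ℕ) :
    IsLocal (Q + b * (t * (Q + 1))) (colorStep bit m Q t b d i) := by
  refine (isLocal_markClusters Q d i).comp (IsLocal.prodMk ?_ ?_)
  · exact isLocal_map (fun _ x => x) _
  · exact (isLocal_weakClustering m Q t b).comp
      (isLocal_map (fun v (x : Option (ClusterMark W)) => match x with
        | none => some v
        | some _ => none) 0)

variable {bit m Q t b d} {G : SimpleGraph W} {st : W → Option (ClusterMark W)} {i : ℕ}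

/-- The labels that `colorStep` works with: living nodes are unmarked, neighbouring living nodes have
the same label, and the clusters have small weak diameter. -/
structure IsWeakClustering (G : SimpleGraph W) (Q : ℕ) (st : W → Option (ClusterMark W))
    (L : W → Option W) : Prop where
  unmarked : ∀ v, L v ≠ none → st v = none
  label_eq : ∀ u v l k, G.Adj u v → L u = some l → L v = some k → l = k
  close : ∀ u v l, L u = some l → L v = some l → u ∈ hopBall G v Q
  half : {v | st v = none}.ncard ≤ 2 * {v | L v ≠ none}.ncard

/-- With `m = 2 * b` the loss over `b` bits is half of the nodes. Two nodes with a common label are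
joined through it, hence the factor `2` in the bound on `Q`. -/
lemma isWeakClustering_weakClustering [Finite W] (hb : 0 < b)
    (hbit : ∀ x y, (∀ j < b, bit x j = bit y j) → x = y)
    (ht : (2 * b) ^ t * Nat.card W < (2 * b + 1) ^ t) (hQ : 2 * (b * t) ≤ Q) :
    IsWeakClustering G Q st (weakClustering bit (2 * b) Q t b G (unmarked st)) := by
  have hs : ∀ v, unmarked st v ≠ none ↔ st v = none := by
    intro v
    unfold unmarked
    rcases st v <;> simp
  have h0 : LabelsWithin 0 G (unmarked st) := by
    intro v l hl
    have : v = l := by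
      unfold unmarked at hl
      rcases h : st v <;> simp_all
    exact this ▸ mem_hopBall_self G v 0
  obtain ⟨h1, h2, h3, h4⟩ := weakClustering_invariant ht h0 b hQ
  refine ⟨fun v hv => (hs v).1 (h3 v hv), fun u v l k huv hu hv => hbit _ _ (h2 u v l k huv hu hv),
    fun u v l hu hv => ?_, ?_⟩
  · exact hopBall_mono _ _ (by omega)
      (mem_hopBall_trans (h1 v l hv) (mem_hopBall_symm (h1 u l hu)))
  · simp only [hs] at h4
    refine Nat.le_of_mul_le_mul_left (c := b) ?_ hb
    linarith

section Mark

variable {L : W → Option W} (hL : IsWeakClustering G Q st L)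

lemma markClusters_of_marked {v : W} {x : ClusterMark W} (h : st v = some x) :
    markClusters Q d i G (fun v => (st v, L v)) v = some x := by
  simp [markClusters, h]

include hL

lemma markClusters_of_label {v l : W} (h : L v = some l) :
    markClusters Q d i G (fun v => (st v, L v)) v =
      (carve d (restrict G {x | L x = some l}) {x | L x = some l} v).map
        fun z => ⟨i + 1, z.1, z.2⟩ := by
  have h1 : st v = none := hL.unmarked v (by simp [h])
  have h2 : {x | x ∈ hopBall G v Q ∧ L x = some l} = {x | L x = some l} := by
    ext x
    exact ⟨fun hx => hx.2, fun hx => ⟨hL.close x v l hx h, hx⟩⟩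
  simp only [markClusters, h1, h, h2]

lemma markClusters_cases {v : W} {x : ClusterMark W}
    (h : markClusters Q d i G (fun v => (st v, L v)) v = some x) :
    st v = some x ∨ ∃ l, L v = some l ∧ x.color = i + 1 ∧
      carve d (restrict G {x | L x = some l}) {x | L x = some l} v = some (x.center, x.parent) := by
  rcases h1 : st v with _ | y
  · rcases h2 : L v with _ | l
    · simp [markClusters, h1, h2] at h
    · rw [markClusters_of_label hL h2, Option.map_eq_some_iff] at h
      obtain ⟨z, hz, rfl⟩ := h
      exact .inr ⟨l, rfl, rfl, hz⟩
  · rw [markClusters_of_marked h1] at h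
    exact .inl h

/-- Old and new clusters differ in color, and adjacent new nodes share their label, so the carving
of that class separates them. -/
lemma IsMarking.markClusters [Finite W] (hd : Nat.card W ≤ 2 ^ d) (hst : IsMarking G d i st) :
    IsMarking G d (i + 1) (LocalDecomp.markClusters Q d i G fun v => (st v, L v)) := by
  classical
  have hcarve : ∀ l, IsCarving (restrict G {x | L x = some l}) {x | L x = some l} d
      (carve d (restrict G {x | L x = some l}) {x | L x = some l}) := fun l => isCarving_carve hd _ _
  have hnew : ∀ v l z, carve d (restrict G {x | L x = some l}) {x | L x = some l} v = some z →
      L v = some l ∧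
        LocalDecomp.markClusters Q d i G (fun v => (st v, L v)) v = some ⟨i + 1, z.1, z.2⟩ := by
    intro v l z h
    have hv : L v = some l := (hcarve l).mem v (by simp [h])
    exact ⟨hv, by rw [markClusters_of_label hL hv, h, Option.map_some]⟩
  obtain ⟨depth, hdepth⟩ := hst.parent
  choose depth' hdepth' using fun l => (hcarve l).parent
  -- Marked nodes have no label, so the old depth and the depths of the carvings are defined on
  -- disjoint sets.
  refine ⟨?_, ?_, ⟨fun v => match L v with
    | none => depth v
    | some l => depth' l v, ?_⟩, ?_⟩
  · intro v x hx
    rcases markClusters_cases hL hx with h | ⟨l, -, h, -⟩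
    · have := hst.color_mem v x h
      omega
    · omega
  · intro v x hx
    rcases markClusters_cases hL hx with h | ⟨l, hl, hc, h⟩
    · obtain ⟨y, hy, hyc⟩ := hst.center v x h
      exact ⟨y, markClusters_of_marked hy, hyc⟩
    · obtain ⟨q, hq⟩ := (hcarve l).center _ _ _ h
      exact ⟨_, (hnew _ _ _ hq).2, rfl, hc.symm⟩
  · have hold : ∀ v x, st v = some x → L v = none := by
      intro v x hx
      by_contra hne
      simp [hL.unmarked v hne] at hx
    intro v x hx
    rcases markClusters_cases hL hx with h | ⟨l, hl, hc, h⟩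
    · simp only [hold v x h]
      refine ⟨(hdepth v x h).1, (hdepth v x h).2.imp id ?_⟩
      rintro ⟨h1, h2, y, hy, hyc⟩
      simp only [hold _ y hy]
      exact ⟨h1, h2, y, markClusters_of_marked hy, hyc⟩
    · simp only [hl]
      refine ⟨(hdepth' l _ _ _ h).1, (hdepth' l _ _ _ h).2.imp id ?_⟩
      rintro ⟨h1, h2, q, hq⟩
      simp only [(hnew _ _ _ hq).1]
      exact ⟨h1.1, h2, _, (hnew _ _ _ hq).2, rfl⟩
  · intro u v x y huv hx hy hne
    rcases markClusters_cases hL hx with h | ⟨l, hl, hc, h⟩ <;>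
      rcases markClusters_cases hL hy with h' | ⟨l', hl', hc', h'⟩
    · exact hst.separated u v x y huv h h' hne
    · have := hst.color_mem u x h
      omega
    · have := hst.color_mem v y h'
      omega
    · obtain rfl := hL.label_eq u v l l' huv hl hl'
      exact absurd ((hcarve l).separated u v _ _ ⟨huv, hl, hl'⟩ h h') hne

/-- At least half of the unmarked nodes survive the clustering, and the carving keeps at least half
of each label class. -/
lemma unmarked_markClusters_le [Finite W] (hd : Nat.card W ≤ 2 ^ d) :
    4 * {v | markClusters Q d i G (fun v => (st v, L v)) v = none}.ncard ≤
      3 * {v | st v = none}.ncard := by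
  classical
  have := Fintype.ofFinite W
  set st' := markClusters Q d i G fun v => (st v, L v)
  have h1 : {v | L v ≠ none}.ncard ≤ 2 * {v | L v ≠ none ∧ st' v ≠ none}.ncard := by
    rw [Set.ncard_eq_toFinset_card', Set.ncard_eq_toFinset_card',
      Finset.card_eq_sum_card_fiberwise (f := L) (t := Finset.univ) (by simp),
      Finset.card_eq_sum_card_fiberwise (s := Set.toFinset {v | L v ≠ none ∧ st' v ≠ none})
        (f := L) (t := Finset.univ) (by simp), Finset.mul_sum]
    refine Finset.sum_le_sum fun o _ => ?_
    rcases o with _ | l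
    · rw [Finset.card_eq_zero.2]
      · exact Nat.zero_le _
      · ext v
        simp
    · have h := (isCarving_carve hd (restrict G {x | L x = some l}) {x | L x = some l})
      have h2 := h.half
      rw [Set.ncard_eq_toFinset_card', Set.ncard_eq_toFinset_card'] at h2
      refine le_trans (Finset.card_le_card ?_) (h2.trans (Nat.mul_le_mul_left 2
        (Finset.card_le_card ?_)))
      · intro v hv
        simpa using (Finset.mem_filter.1 hv).2
      · intro v hv
        have hv' : carve d (restrict G {x | L x = some l}) {x | L x = some l} v ≠ none := by
          simpa using hv
        have hl : L v = some l := h.mem v hv'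
        have hs : st' v ≠ none := by
          simp only [st', markClusters_of_label hL hl, Ne, Option.map_eq_none_iff]
          exact hv'
        simp [hl, hs]
  have h2 : {v | st' v = none}.ncard + {v | L v ≠ none ∧ st' v ≠ none}.ncard ≤
      {v | st v = none}.ncard := by
    rw [← Set.ncard_union_eq]
    · refine Set.ncard_le_ncard ?_
      rintro v (hv | ⟨hv, -⟩)
      · by_contra hne
        obtain ⟨x, hx⟩ := Option.ne_none_iff_exists'.1 hne
        simp [st', markClusters_of_marked hx] at hv
      · exact hL.unmarked v hv
    · rw [Set.disjoint_left]
      exact fun v hv hv' => hv'.2 hv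
  have h3 := hL.half
  omega

end Mark

/-- The whole decomposition: one color after the other. -/
noncomputable def colorAll (bit : W → ℕ → Bool) (m Q t b d c : ℕ) (G : SimpleGraph W)
    (st : W → Option (ClusterMark W)) : W → Option (ClusterMark W) :=
  compSeq (colorStep bit m Q t b d) G st c

lemma isLocal_colorAll (c : ℕ) :
    IsLocal (c * (Q + b * (t * (Q + 1)))) (colorAll bit m Q t b d c) :=
  IsLocal.compSeq (isLocal_colorStep bit m Q t b d) c

lemma isMarking_colorAll [Finite W] (hb : 0 < b)
    (hbit : ∀ x y, (∀ j < b, bit x j = bit y j) → x = y)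
    (ht : (2 * b) ^ t * Nat.card W < (2 * b + 1) ^ t) (hQ : 2 * (b * t) ≤ Q)
    (hd : Nat.card W ≤ 2 ^ d) (G : SimpleGraph W) (c : ℕ) :
    IsMarking G d c (colorAll bit (2 * b) Q t b d c G fun _ => none) ∧
      4 ^ c * {v | colorAll bit (2 * b) Q t b d c G (fun _ => none) v = none}.ncard ≤
        3 ^ c * Nat.card W := by
  induction c with
  | zero =>
    refine ⟨⟨by simp [colorAll, compSeq], by simp [colorAll, compSeq], ⟨fun _ => 0, ?_⟩,
      by simp [colorAll, compSeq]⟩, ?_⟩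
    · simp [colorAll, compSeq]
    · simpa using Set.ncard_le_card _
  | succ c ih =>
    have e : colorAll bit (2 * b) Q t b d (c + 1) G (fun _ => none) =
        colorStep bit (2 * b) Q t b d c G (colorAll bit (2 * b) Q t b d c G fun _ => none) := rfl
    rw [e]
    generalize (colorAll bit (2 * b) Q t b d c G fun _ => none) = st at ih
    have hL := isWeakClustering_weakClustering (G := G) (st := st) hb hbit ht hQ
    refine ⟨ih.1.markClusters hL hd, ?_⟩
    have h1 := unmarked_markClusters_le (i := c) hL hd
    have h2 := ih.2
    rw [colorStep, pow_succ, pow_succ]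
    nlinarith [Nat.mul_le_mul_left (4 ^ c) h1]

end Coloring

/-! ### Numerical parameters -/

section Parameters

/-- The binary digits of `x` as a function. -/
def binaryDigit (b : ℕ) (x : Fin (2 ^ b)) (j : ℕ) : Bool := x.val.testBit j

lemma binaryDigit_injective {b : ℕ} (x y : Fin (2 ^ b))
    (h : ∀ j < b, binaryDigit b x j = binaryDigit b y j) : x = y := by
  refine Fin.ext (Nat.eq_of_testBit_eq fun j => ?_)
  by_cases hj : j < b
  · exact h j hj
  · have : 2 ^ b ≤ 2 ^ j := Nat.pow_le_pow_right (by norm_num) (not_lt.1 hj)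
    rw [Nat.testBit_lt_two_pow (x.2.trans_le this), Nat.testBit_lt_two_pow (y.2.trans_le this)]

/-- By Bernoulli's inequality `2 * b` steps with `m = 2 * b` double a cluster, and `b + 1` doublings
exceed `2 ^ b`. -/
lemma two_pow_mul_lt (b : ℕ) (hb : 0 < b) :
    (2 * b) ^ (2 * b * (b + 1)) * 2 ^ b < (2 * b + 1) ^ (2 * b * (b + 1)) := by
  have h1 : 2 * (2 * b) ^ (2 * b) ≤ (2 * b + 1) ^ (2 * b) := by
    have h := pow_add_mul_le_add_pow (R := ℕ) (a := 2 * b) (b := 1) (Nat.zero_le _) (by omega) (2 * b)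
    have e : 2 * b * (2 * b) ^ (2 * b - 1) * 1 = (2 * b) ^ (2 * b) := by
      rw [mul_one, mul_pow_sub_one (by omega)]
    simp only [Nat.cast_id] at h
    omega
  calc _ < (2 * b) ^ (2 * b * (b + 1)) * 2 ^ (b + 1) := by
        gcongr <;> omega
    _ = (2 * (2 * b) ^ (2 * b)) ^ (b + 1) := by
      rw [mul_pow 2 ((2 * b) ^ (2 * b)), ← pow_mul, mul_comm]
    _ ≤ ((2 * b + 1) ^ (2 * b)) ^ (b + 1) := by gcongr
    _ = _ := by rw [← pow_mul]

/-- Three colors more than halve the number of unmarked nodes, because `3 ^ 3 * 2 ≤ 4 ^ 3`. -/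
lemma three_pow_mul_lt (b : ℕ) : 3 ^ (3 * (b + 1)) * 2 ^ b < 4 ^ (3 * (b + 1)) := by
  calc 3 ^ (3 * (b + 1)) * 2 ^ b < 3 ^ (3 * (b + 1)) * 2 ^ (b + 1) := by
        gcongr <;> omega
    _ = (3 ^ 3 * 2) ^ (b + 1) := by rw [mul_pow, ← pow_mul]
    _ ≤ (4 ^ 3) ^ (b + 1) := by gcongr; norm_num
    _ = _ := by rw [← pow_mul]

end Parameters

end LocalDecomp

namespace LocalDecomp

/-! ### Trees given by parent pointers -/

section ParentTree

variable {X : Type*} {T : SimpleGraph X} {root : X} {par : X → X} {depth : X → ℕ}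

lemma edist_root_le (hpar : ∀ x, x ≠ root → T.Adj x (par x) ∧ depth (par x) < depth x) (x : X) :
    T.edist x root ≤ depth x := by
  induction hn : depth x using Nat.strong_induction_on generalizing x with
  | _ n ih =>
    by_cases hx : x = root
    · simp [hx]
    · obtain ⟨h1, h2⟩ := hpar x hx
      calc T.edist x root ≤ T.edist x (par x) + T.edist (par x) root := T.edist_triangle
        _ ≤ 1 + (depth (par x) : ℕ∞) := by
            gcongr
            · exact (SimpleGraph.edist_eq_one_iff_adj.2 h1).le
            · exact ih _ (hn ▸ h2) _ rfl
        _ ≤ (n : ℕ∞) := by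
            rw [← hn]
            exact_mod_cast (by omega : 1 + depth (par x) ≤ depth x)

/-- Pointers to parents that lead to a root form a tree. -/
lemma isTree_of_parent [Finite X]
    (hpar : ∀ x, x ≠ root → T.Adj x (par x) ∧ depth (par x) < depth x)
    (hadj : ∀ x y, T.Adj x y → (x ≠ root ∧ par x = y) ∨ (y ≠ root ∧ par y = x)) : T.IsTree := by
  classical
  have := Fintype.ofFinite X
  have hc : T.Connected := by
    rw [SimpleGraph.connected_iff_exists_forall_reachable]
    refine ⟨root, fun x => (SimpleGraph.reachable_of_edist_ne_top ?_).symm⟩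
    exact ne_top_of_le_ne_top (ENat.natCast_ne_top _) (edist_root_le hpar x)
  rw [SimpleGraph.isTree_iff_connected_and_card]
  refine ⟨hc, le_antisymm ?_ hc.card_vert_le_card_edgeSet_add_one⟩
  -- Every edge is the pointer of some vertex other than the root, so there are at most `|X| - 1`
  -- edges; connectedness gives the reverse bound.
  have h1 : T.edgeSet ⊆ (fun x => s(x, par x)) '' {x | x ≠ root} := by
    intro z
    induction z using Sym2.ind with
    | _ x y =>
      intro h
      rcases hadj x y h with ⟨hx, rfl⟩ | ⟨hy, rfl⟩
      · exact ⟨x, hx, rfl⟩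
      · exact ⟨y, hy, Sym2.eq_swap⟩
  have h2 : Nat.card T.edgeSet ≤ {x | x ≠ root}.ncard :=
    (Set.ncard_le_ncard h1).trans (Set.ncard_image_le)
  have h3 : {x | x ≠ root}.ncard + 1 = Nat.card X := by
    have := Set.ncard_add_ncard_compl {root}
    rw [Set.ncard_singleton] at this
    rw [← this, add_comm]
    rfl
  omega

lemma ediam_le_of_parent {d : ℕ}
    (hpar : ∀ x, x ≠ root → T.Adj x (par x) ∧ depth (par x) < depth x)
    (hd : ∀ x, depth x ≤ d) : T.ediam ≤ (2 * d : ℕ) := by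
  refine SimpleGraph.ediam_le_of_edist_le fun x y => ?_
  calc T.edist x y ≤ T.edist x root + T.edist root y := T.edist_triangle
    _ ≤ (d : ℕ∞) + d := by
        rw [T.edist_comm (u := root)]
        gcongr
        · exact (edist_root_le hpar x).trans (by exact_mod_cast hd x)
        · exact (edist_root_le hpar y).trans (by exact_mod_cast hd y)
    _ = _ := by push_cast; ring

end ParentTree

/-! ### Collecting the neighbourhood by message passing -/

section Gather

/-- What a node of the full-information algorithm has learned: `n`, its identifier, and a set of
edges of the network, as pairs of identifiers. -/
structure Knowledge where
  bound : ℕ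
  ident : ℕ
  edges : Set (ℕ × ℕ)

/-- In every round the nodes exchange their identifiers and all edges that they know of. -/
def gather {Out : Type} (rounds : ℕ → ℕ) (output : ℕ → ℕ → Set (ℕ × ℕ) → Out) :
    LocalAlgorithm Out where
  State := Knowledge
  Msg := ℕ × Set (ℕ × ℕ)
  bits _ := 0
  rounds := rounds
  init n x _ := ⟨n, x, ∅⟩
  send s _ := (s.ident, s.edges)
  receive s box := ⟨s.bound, s.ident,
    s.edges ∪ {e | ∃ p m, box p = some m ∧ (e ∈ m.2 ∨ e = (s.ident, m.1))}⟩
  output s := output s.bound s.ident s.edges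

variable {V : Type} (N : Network V)

/-- The edges of a network as pairs of identifiers. -/
def identEdges : Set (ℕ × ℕ) := {e | ∃ u v, N.graph.Adj u v ∧ e = (N.ident u, N.ident v)}

variable {N} {Out : Type} {A : LocalAlgorithm Out} {s : V → A.State} {u v : V}

lemma inbox_eq_some {p : ℕ} {m : A.Msg} (h : A.inbox N s v p = some m) :
    ∃ u q, N.graph.Adj v u ∧ m = A.send (s u) q := by
  unfold LocalAlgorithm.inbox at h
  split_ifs at h with hp
  exact ⟨_, _, ((N.port v).symm ⟨p, hp⟩).2, (Option.some.inj h).symm⟩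

lemma exists_inbox_eq (h : N.graph.Adj v u) :
    ∃ p q, A.inbox N s v p = some (A.send (s u) q) := by
  obtain ⟨q, hq⟩ : ∃ q, A.inbox N s v (N.port v ⟨u, h⟩) =
      some (A.send (s ((N.port v).symm (N.port v ⟨u, h⟩))) q) :=
    ⟨_, dif_pos (N.port v ⟨u, h⟩).2⟩
  rw [Equiv.symm_apply_apply] at hq
  exact ⟨_, q, hq⟩

variable {rounds : ℕ → ℕ} {output : ℕ → ℕ → Set (ℕ × ℕ) → Out} {n : ℕ}
  {r : V → Fin ((gather rounds output).bits n) → Bool}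

lemma gather_state (t : ℕ) : ∀ v, ((gather rounds output).stateAfter N n r t v).bound = n ∧
    ((gather rounds output).stateAfter N n r t v).ident = N.ident v := by
  induction t with
  | zero => exact fun v => ⟨rfl, rfl⟩
  | succ t ih => exact fun v => ih v

lemma gather_run (v : V) : (gather rounds output).run N n r v =
    output n (N.ident v) ((gather rounds output).stateAfter N n r (rounds n) v).edges := by
  change output ((gather rounds output).stateAfter N n r (rounds n) v).bound
    ((gather rounds output).stateAfter N n r (rounds n) v).ident _ = _
  rw [(gather_state (rounds n) v).1, (gather_state (rounds n) v).2]
  rfl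

lemma gather_edges_subset (t : ℕ) : ∀ v,
    ((gather rounds output).stateAfter N n r t v).edges ⊆ identEdges N := by
  induction t with
  | zero => exact fun v => Set.empty_subset _
  | succ t ih =>
    rintro v e (he | ⟨p, m, hm, he⟩)
    · exact ih v he
    · obtain ⟨u, q, hu, rfl⟩ := inbox_eq_some hm
      rcases he with he | rfl
      · exact ih u he
      · exact ⟨v, u, hu, by rw [(gather_state t v).2]; exact congrArg _ (gather_state t u).2⟩

/-- The extra round is needed because a node initially does not know its neighbours' identifiers;
afterwards knowledge travels one hop per round. -/
lemma mem_gather_edges (t : ℕ) : ∀ v, ∀ u ∈ hopBall N.graph v t, ∀ w, N.graph.Adj u w →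
    (N.ident u, N.ident w) ∈ ((gather rounds output).stateAfter N n r (t + 1) v).edges := by
  have self : ∀ t v w, N.graph.Adj v w →
      (N.ident v, N.ident w) ∈ ((gather rounds output).stateAfter N n r (t + 1) v).edges := by
    intro t v w hw
    obtain ⟨p, q, hpq⟩ := exists_inbox_eq (A := gather rounds output)
      (s := (gather rounds output).stateAfter N n r t) hw
    refine .inr ⟨p, _, hpq, .inr ?_⟩
    rw [(gather_state t v).2]
    exact congrArg _ (gather_state t w).2.symm
  induction t with
  | zero =>
    rintro v u ⟨p, hp⟩ w hw
    obtain rfl := SimpleGraph.Walk.eq_of_length_eq_zero (p := p) (by omega)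
    exact self 0 v w hw
  | succ t ih =>
    rintro v u ⟨p, hp⟩ w hw
    cases p with
    | nil => exact self _ v w hw
    | cons h p' =>
      obtain ⟨p, q, hpq⟩ := exists_inbox_eq (A := gather rounds output)
        (s := (gather rounds output).stateAfter N n r (t + 1)) h
      exact .inr ⟨p, _, hpq, .inl (ih _ u ⟨p', by simpa using hp⟩ w hw)⟩

/-- The graph on the possible identifiers with the given edges. -/
def edgeGraph (b : ℕ) (K : Set (ℕ × ℕ)) : SimpleGraph (Fin (2 ^ b)) where
  Adj x y := x ≠ y ∧ ((x.val, y.val) ∈ K ∨ (y.val, x.val) ∈ K)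
  symm := ⟨fun _ _ h => ⟨h.1.symm, h.2.symm⟩⟩
  loopless := ⟨fun _ h => h.1 rfl⟩

lemma edgeGraph_identEdges_adj {b : ℕ} {x y : Fin (2 ^ b)} :
    (edgeGraph b (identEdges N)).Adj x y ↔
      ∃ u v, N.graph.Adj u v ∧ N.ident u = x ∧ N.ident v = y := by
  constructor
  · rintro ⟨-, ⟨u, v, h, e⟩ | ⟨u, v, h, e⟩⟩
    · exact ⟨u, v, h, (Prod.mk.inj e).1.symm, (Prod.mk.inj e).2.symm⟩
    · exact ⟨v, u, h.symm, (Prod.mk.inj e).2.symm, (Prod.mk.inj e).1.symm⟩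
  · rintro ⟨u, v, h, hu, hv⟩
    refine ⟨fun hxy => h.ne (N.ident_injective ?_), .inl ⟨u, v, h, by rw [hu, hv]⟩⟩
    rw [hu, hv, hxy]

/-- Unused identifiers are isolated, so a walk that starts at the identifier of a node lifts to the
network. -/
lemma exists_ident_of_mem_hopBall {b t : ℕ} {x y : Fin (2 ^ b)} (hv : N.ident v = x)
    (h : y ∈ hopBall (edgeGraph b (identEdges N)) x t) :
    ∃ u ∈ hopBall N.graph v t, N.ident u = y := by
  obtain ⟨p, hp⟩ := h
  induction p generalizing v t with
  | nil => exact ⟨v, mem_hopBall_self _ _ _, hv⟩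
  | cons hadj p ih =>
    obtain ⟨v', w, hw, hv', hwx⟩ := edgeGraph_identEdges_adj.1 hadj
    obtain rfl := N.ident_injective (hv'.trans hv.symm)
    obtain ⟨k, rfl⟩ : ∃ k, t = 1 + k := ⟨t - 1, by simp at hp; omega⟩
    obtain ⟨u, hu, hux⟩ := ih (t := k) hwx (by simp at hp; omega)
    exact ⟨u, mem_hopBall_trans (mem_hopBall_of_adj hw) hu, hux⟩

/-- After `t + 1` rounds a node knows its neighbourhood of radius `t`. -/
lemma agreeOn_gather {α : Type*} {b : ℕ} (t : ℕ) {x : Fin (2 ^ b)} (hv : N.ident v = x)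
    (st : Fin (2 ^ b) → α) :
    AgreeOn t (edgeGraph b (identEdges N))
      (edgeGraph b ((gather rounds output).stateAfter N n r (t + 1) v).edges) st st x := by
  intro y hy
  refine ⟨fun z => ⟨fun h => ⟨h.ne, ?_⟩, fun h => ⟨h.1, ?_⟩⟩, rfl⟩
  · obtain ⟨u, hu, huy⟩ := exists_ident_of_mem_hopBall hv hy
    obtain ⟨u', w, hw, hu', hwz⟩ := edgeGraph_identEdges_adj.1 h
    obtain rfl := N.ident_injective (hu'.trans huy.symm)
    left
    rw [← huy, ← hwz]
    exact mem_gather_edges t v u' hu w hw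
  · exact h.2.imp (fun h => gather_edges_subset _ v h) (fun h => gather_edges_subset _ v h)

end Gather

end LocalDecomp

namespace LocalDecomp

/-! ### From marks to a network decomposition -/

section Output

variable {b : ℕ}

/-- Whether the edge between `v` and `u` belongs to the tree of a cluster. -/
def IsTreeEdge (G : SimpleGraph (Fin (2 ^ b))) (st : Fin (2 ^ b) → Option (ClusterMark (Fin (2 ^ b))))
    (v u : Fin (2 ^ b)) : Prop :=
  G.Adj v u ∧ ∃ x y, st v = some x ∧ st u = some y ∧ x.center = y.center ∧
    ((v ≠ x.center ∧ x.parent = u) ∨ (u ≠ y.center ∧ y.parent = v))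

/-- The output of a node, given the marks of the decomposition. -/
noncomputable def decompOutput (G : SimpleGraph (Fin (2 ^ b)))
    (st : Fin (2 ^ b) → Option (ClusterMark (Fin (2 ^ b)))) (v : Fin (2 ^ b)) : DecompOutput :=
  open Classical in
  match st v with
  | none => ⟨0, 0, ∅⟩
  | some x => ⟨x.center, x.color,
      (Finset.univ.filter fun u => IsTreeEdge G st v u).map Fin.valEmbedding⟩

lemma isLocal_decompOutput : IsLocal 1 (decompOutput (b := b)) := by
  intro G G' s s' v ha
  have h : ∀ u, IsTreeEdge G s v u ↔ IsTreeEdge G' s' v u := by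
    intro u
    unfold IsTreeEdge
    rw [← ha.adj_iff u, ← ha.label_eq]
    refine and_congr_right fun hu => ?_
    rw [(ha u (mem_hopBall_of_adj hu)).2]
  have h' : IsTreeEdge G s v = IsTreeEdge G' s' v := funext fun u => propext (h u)
  unfold decompOutput
  rw [h', ha.label_eq]

/-- The outputs of a complete marking of the graph of identifiers form a network decomposition. -/
lemma IsMarking.isNetworkDecomposition {V : Type} [Finite V] {N : Network V} {d c : ℕ}
    {st : Fin (2 ^ b) → Option (ClusterMark (Fin (2 ^ b)))} {f : V → Fin (2 ^ b)}
    (hf : ∀ v, N.ident v = f v) (h : IsMarking (edgeGraph b (identEdges N)) d c st)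
    (htotal : ∀ x, st x ≠ none) :
    IsNetworkDecomposition N (2 * d) c
      fun v => decompOutput (edgeGraph b (identEdges N)) st (f v) := by
  set G := edgeGraph b (identEdges N) with hG
  have hinj : ∀ u v, f u = f v → u = v := fun u v huv =>
    N.ident_injective (by rw [hf, hf, huv])
  have hadj : ∀ u v, N.graph.Adj u v ↔ G.Adj (f u) (f v) := by
    intro u v
    rw [hG, edgeGraph_identEdges_adj]
    refine ⟨fun h => ⟨u, v, h, hf u, hf v⟩, ?_⟩
    rintro ⟨u', v', h, hu, hv⟩
    rwa [← N.ident_injective (hu.trans (hf u).symm), ← N.ident_injective (hv.trans (hf v).symm)]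
  have hnbr : ∀ u x, G.Adj (f u) x → ∃ v, f v = x := by
    intro u x hx
    obtain ⟨-, w, -, -, hw⟩ := edgeGraph_identEdges_adj.1 hx
    exact ⟨w, Fin.ext ((hf w).symm.trans hw)⟩
  choose mark hmark using fun x => Option.ne_none_iff_exists'.1 (htotal x)
  -- The center determines the color, so it can serve as the label of its cluster.
  have hcol : ∀ x, (mark x).color = (mark (mark x).center).color ∧
      (mark (mark x).center).center = (mark x).center := by
    intro x
    obtain ⟨y, hy, hy1, hy2⟩ := h.center x _ (hmark x)
    obtain rfl := Option.some.inj ((hmark _).symm.trans hy)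
    exact ⟨hy2.symm, hy1⟩
  obtain ⟨depth, hdepth'⟩ := h.parent
  have hdepth : ∀ x, depth x ≤ d := fun x => (hdepth' x _ (hmark x)).1
  have hparent : ∀ x, x ≠ (mark x).center → G.Adj x (mark x).parent ∧
      depth (mark x).parent < depth x ∧ (mark (mark x).parent).center = (mark x).center := by
    intro x hx
    obtain ⟨h1, h2, y, hy, hyc⟩ := ((hdepth' x _ (hmark x)).2).resolve_left hx
    obtain rfl := Option.some.inj ((hmark _).symm.trans hy)
    exact ⟨h1, h2, hyc⟩
  have hedge : ∀ x y, IsTreeEdge G st x y ↔ G.Adj x y ∧ (mark x).center = (mark y).center ∧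
      ((x ≠ (mark x).center ∧ (mark x).parent = y) ∨
        (y ≠ (mark y).center ∧ (mark y).parent = x)) := by
    intro x y
    simp only [IsTreeEdge, hmark, Option.some.injEq]
    refine and_congr_right fun _ => ⟨?_, fun h => ⟨_, _, rfl, rfl, h⟩⟩
    rintro ⟨_, _, rfl, rfl, h⟩
    exact h
  -- A center is so far only a possible identifier. Parent pointers follow edges, which join
  -- identifiers of actual nodes, and reach the center by descent on the depth.
  have hroot : ∀ v, ∃ w, f w = (mark (f v)).center := by
    intro v
    induction hn : depth (f v) using Nat.strong_induction_on generalizing v with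
    | _ n ih =>
      by_cases hv : f v = (mark (f v)).center
      · exact ⟨v, hv⟩
      · obtain ⟨h1, h2, h3⟩ := hparent _ hv
        obtain ⟨u, hu⟩ := hnbr _ _ h1
        rw [← h3, ← hu]
        exact ih _ (by rw [hu, ← hn]; exact h2) u rfl
  have hout : ∀ v, decompOutput G st (f v) = ⟨(mark (f v)).center, (mark (f v)).color,
      open Classical in
      (Finset.univ.filter fun u => IsTreeEdge G st (f v) u).map Fin.valEmbedding⟩ := by
    intro v
    simp only [decompOutput, hmark]
  simp only [hout]
  refine ⟨fun v => h.color_mem _ _ (hmark (f v)), ?_, ?_, ?_⟩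
  · intro u v huv
    rw [(hcol (f u)).1, (hcol (f v)).1, Fin.ext huv]
  · intro u v huv hne
    exact h.separated _ _ _ _ ((hadj u v).1 huv) (hmark _) (hmark _) fun e => hne (by rw [e])
  · intro v
    obtain ⟨r, hr⟩ := hroot v
    let T : N.graph.Subgraph :=
      { verts := {u | ((mark (f u)).center : ℕ) = (mark (f v)).center}
        Adj := fun u w => ((mark (f u)).center : ℕ) = (mark (f v)).center ∧
          IsTreeEdge G st (f u) (f w)
        adj_sub := fun h => (hadj _ _).2 h.2.1
        edge_vert := fun h => h.1
        symm := ⟨by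
          rintro u w ⟨h1, h2⟩
          have h3 := (hedge _ _).1 h2
          refine ⟨by rw [← h3.2.1, h1], (hedge _ _).2 ⟨h3.1.symm, h3.2.1.symm, h3.2.2.symm⟩⟩⟩ }
    have hmem : ∀ u : T.verts, (mark (f u)).center = f r := fun u => (Fin.ext u.2).trans hr.symm
    let root : T.verts := ⟨r, by
      change ((mark (f r)).center : ℕ) = _
      rw [hr, (hcol (f v)).2]⟩
    have hpar : ∀ u : T.verts, ∃ w : T.verts, u ≠ root → T.coe.Adj u w ∧
        depth (f w) < depth (f u) ∧ f w = (mark (f u)).parent := by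
      intro u
      by_cases hu : u = root
      · exact ⟨u, fun h => absurd hu h⟩
      have hu' : f u ≠ (mark (f u)).center := by
        rw [hmem u]
        exact fun h => hu (Subtype.ext (hinj _ _ h))
      obtain ⟨h1, h2, h3⟩ := hparent _ hu'
      obtain ⟨w, hw⟩ := hnbr _ _ h1
      rw [← hw] at h1 h2 h3
      refine ⟨⟨w, by
        change ((mark (f w)).center : ℕ) = _
        rw [h3]
        exact u.2⟩, fun _ => ⟨⟨u.2, (hedge _ _).2 ⟨h1, h3.symm, .inl ⟨hu', hw.symm⟩⟩⟩, h2, hw⟩⟩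
    choose par hpar using hpar
    have hpar' : ∀ u, u ≠ root → T.coe.Adj u (par u) ∧ depth (f (par u)) < depth (f u) :=
      fun u hu => ⟨(hpar u hu).1, (hpar u hu).2.1⟩
    -- The pointer of a center is meaningless; tree edges come only from the pointers of other
    -- nodes, which are not the root.
    have key : ∀ u w : T.verts, f u ≠ (mark (f u)).center → (mark (f u)).parent = f w →
        u ≠ root ∧ par u = w := by
      intro u w hu huw
      have hne : u ≠ root := fun e => hu (by rw [hmem u, e])
      exact ⟨hne, Subtype.ext (hinj _ _ ((hpar u hne).2.2.trans huw))⟩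
    refine ⟨T, rfl, isTree_of_parent (depth := fun u => depth (f u)) hpar' ?_,
      ediam_le_of_parent (T := T.coe) (depth := fun u => depth (f u)) hpar' fun u => hdepth _, ?_⟩
    · intro u w huw
      obtain ⟨-, -, h | h⟩ := (hedge _ _).1 huw.2
      · exact .inl (key u w h.1 h.2)
      · exact .inr (key w u h.1 h.2)
    · intro u hu
      ext k
      simp only [Finset.coe_map, Set.mem_image, Finset.mem_coe, Finset.mem_filter, Finset.mem_univ,
        true_and, SimpleGraph.Subgraph.mem_neighborSet]
      constructor
      · rintro ⟨x, hx, rfl⟩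
        obtain ⟨w, rfl⟩ := hnbr _ _ hx.1
        exact ⟨w, ⟨hu, hx⟩, hf w⟩
      · rintro ⟨w, hw, rfl⟩
        exact ⟨f w, hw.2, (hf w).symm⟩

end Output

/-! ### Closure properties of polylogarithmic functions -/

section Polylog

lemma eventually_one_le_log : ∀ᶠ n : ℕ in atTop, 1 ≤ Real.log n :=
  (Real.tendsto_log_atTop.comp tendsto_natCast_atTop_atTop).eventually_ge_atTop 1

lemma isBigO_log_pow {C D : ℕ} (h : C ≤ D) :
    (fun n : ℕ => Real.log n ^ C) =O[atTop] fun n : ℕ => Real.log n ^ D := by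
  refine IsBigO.of_bound 1 ?_
  filter_upwards [eventually_one_le_log] with n hn
  rw [one_mul, Real.norm_of_nonneg (by positivity), Real.norm_of_nonneg (by positivity)]
  exact pow_le_pow_right₀ hn h

lemma isPolylog_const (k : ℕ) : IsPolylog fun _ => k :=
  ⟨0, by simpa only [pow_zero] using isBigO_const_const (k : ℝ) (one_ne_zero (α := ℝ)) atTop⟩

lemma _root_.IsPolylog.add {f g : ℕ → ℕ} (hf : IsPolylog f) (hg : IsPolylog g) :
    IsPolylog fun n => f n + g n := by
  obtain ⟨C, hC⟩ := hf
  obtain ⟨D, hD⟩ := hg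
  refine ⟨C + D, ?_⟩
  push_cast
  exact (hC.trans (isBigO_log_pow (Nat.le_add_right C D))).add
    (hD.trans (isBigO_log_pow (Nat.le_add_left D C)))

lemma _root_.IsPolylog.mul {f g : ℕ → ℕ} (hf : IsPolylog f) (hg : IsPolylog g) :
    IsPolylog fun n => f n * g n := by
  obtain ⟨C, hC⟩ := hf
  obtain ⟨D, hD⟩ := hg
  refine ⟨C + D, ?_⟩
  simpa only [Nat.cast_mul, pow_add] using hC.mul hD

lemma isPolylog_log : IsPolylog (Nat.log 2) := by
  refine ⟨1, IsBigO.of_bound (Real.log 2)⁻¹ ?_⟩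
  filter_upwards [eventually_one_le_log] with n hn
  rw [pow_one, Real.norm_of_nonneg (by positivity), Real.norm_of_nonneg (by positivity)]
  refine (Real.natLog_le_logb n 2).trans (le_of_eq ?_)
  rw [Real.logb, div_eq_inv_mul, Nat.cast_ofNat]

end Polylog

/-! ### The algorithm and its correctness -/

section Main

/-- The length of the binary representation of identifiers up to `n ^ a`. -/
def identBits (a n : ℕ) : ℕ := a * (Nat.log 2 n + 1) + 1

/-- The number of steps for each bit. -/
def stepCount (b : ℕ) : ℕ := 2 * b * (b + 1)

/-- A bound on the weak diameter of the clusters. -/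
def weakDiameter (b : ℕ) : ℕ := 2 * (b * stepCount b)

/-- The number of colors. -/
def colorCount (b : ℕ) : ℕ := 3 * (b + 1)

/-- The locality of the decomposition. -/
def decompRadius (b : ℕ) : ℕ :=
  1 + colorCount b * (weakDiameter b + b * (stepCount b * (weakDiameter b + 1)))

/-- The marks of the decomposition of a graph on the possible identifiers. -/
noncomputable def decompMarks (b : ℕ) (G : SimpleGraph (Fin (2 ^ b))) :
    Fin (2 ^ b) → Option (ClusterMark (Fin (2 ^ b))) :=
  colorAll (binaryDigit b) (2 * b) (weakDiameter b) (stepCount b) b b (colorCount b) G fun _ => none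

lemma decompMarks_spec {b : ℕ} (hb : 0 < b) (G : SimpleGraph (Fin (2 ^ b))) :
    IsMarking G b (colorCount b) (decompMarks b G) ∧ ∀ x, decompMarks b G x ≠ none := by
  have hcard : Nat.card (Fin (2 ^ b)) = 2 ^ b := Nat.card_fin _
  obtain ⟨h1, h2⟩ := isMarking_colorAll (bit := binaryDigit b) (Q := weakDiameter b)
    (t := stepCount b) hb binaryDigit_injective (by rw [hcard]; exact two_pow_mul_lt b hb) le_rfl
    hcard.le G (colorCount b)
  refine ⟨h1, fun x hx => ?_⟩
  rw [hcard] at h2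
  have h3 := h2.trans_lt (three_pow_mul_lt b)
  have h4 : 0 < {v | decompMarks b G v = none}.ncard := (Set.ncard_pos).2 ⟨x, hx⟩
  exact absurd h3 (not_lt.2 (Nat.le_mul_of_pos_right _ h4))

/-- The output of the node with identifier `k` that knows the edges in `K`. -/
noncomputable def decompRule (a n k : ℕ) (K : Set (ℕ × ℕ)) : DecompOutput :=
  if h : k < 2 ^ identBits a n then
    decompOutput (edgeGraph (identBits a n) K)
      (decompMarks (identBits a n) (edgeGraph (identBits a n) K)) ⟨k, h⟩
  else ⟨0, 0, ∅⟩

/-- The decomposition algorithm: every node gathers its neighbourhood of polylogarithmic radius and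
computes its own part of the decomposition. It derandomizes the construction completely: it reads no
random bits and always succeeds. -/
noncomputable def decompAlgorithm (a : ℕ) : LocalAlgorithm DecompOutput :=
  gather (fun n => decompRadius (identBits a n) + 1) (decompRule a)

lemma pow_lt_two_pow_identBits (a n : ℕ) : n ^ a < 2 ^ identBits a n := by
  calc n ^ a ≤ (2 ^ (Nat.log 2 n + 1)) ^ a := by
        gcongr
        exact (Nat.lt_pow_succ_log_self (by norm_num) n).le
    _ = 2 ^ (a * (Nat.log 2 n + 1)) := by rw [← pow_mul, mul_comm]
    _ < 2 ^ identBits a n := Nat.pow_lt_pow_right (by norm_num) (Nat.lt_succ_self _)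

/-- One function of the graph of identifiers gives a correct output. It is local with radius
`decompRadius`, so evaluating it on the edges known after `decompRadius + 1` rounds gives the same
value at the node itself. -/
lemma decompAlgorithm_correct (a n : ℕ) {V : Type} [Finite V] (N : Network V)
    (hN : ∀ v, N.ident v ≤ n ^ a) (r : V → Fin ((decompAlgorithm a).bits n) → Bool) :
    IsNetworkDecomposition N (2 * identBits a n) (colorCount (identBits a n))
      ((decompAlgorithm a).run N n r) := by
  have hb : 0 < identBits a n := Nat.succ_pos _
  have hlt : ∀ v, N.ident v < 2 ^ identBits a n := fun v =>
    (hN v).trans_lt (pow_lt_two_pow_identBits a n)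
  obtain ⟨h1, h2⟩ := decompMarks_spec hb (edgeGraph (identBits a n) (identEdges N))
  have h3 := h1.isNetworkDecomposition (f := fun v => ⟨N.ident v, hlt v⟩) (fun _ => rfl) h2
  have hloc : IsLocal (decompRadius (identBits a n)) _ :=
    isLocal_decompOutput.comp (isLocal_colorAll (bit := binaryDigit (identBits a n))
      (m := 2 * identBits a n) (Q := weakDiameter (identBits a n)) (t := stepCount (identBits a n))
      (b := identBits a n) (d := identBits a n) (colorCount (identBits a n)))
  convert h3 using 1
  funext v
  refine (gather_run v).trans ?_
  rw [decompRule, dif_pos (hlt v)]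
  exact (hloc _ _ _ _ _ (agreeOn_gather _ rfl fun _ => none)).symm

lemma isPolylog_identBits (a : ℕ) : IsPolylog (identBits a) :=
  ((isPolylog_const a).mul (isPolylog_log.add (isPolylog_const 1))).add (isPolylog_const 1)

variable {f : ℕ → ℕ}

lemma _root_.IsPolylog.stepCount (hf : IsPolylog f) : IsPolylog fun n => LocalDecomp.stepCount (f n) :=
  ((isPolylog_const 2).mul hf).mul (hf.add (isPolylog_const 1))

lemma _root_.IsPolylog.weakDiameter (hf : IsPolylog f) :
    IsPolylog fun n => LocalDecomp.weakDiameter (f n) :=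
  (isPolylog_const 2).mul (hf.mul hf.stepCount)

lemma _root_.IsPolylog.colorCount (hf : IsPolylog f) : IsPolylog fun n => LocalDecomp.colorCount (f n) :=
  (isPolylog_const 3).mul (hf.add (isPolylog_const 1))

lemma _root_.IsPolylog.decompRadius (hf : IsPolylog f) :
    IsPolylog fun n => LocalDecomp.decompRadius (f n) :=
  (isPolylog_const 1).add (hf.colorCount.mul (hf.weakDiameter.add
    (hf.mul (hf.stepCount.mul (hf.weakDiameter.add (isPolylog_const 1))))))

end Main

end LocalDecomp

theorem mainTheorem5 (a e : ℕ) :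
    ∃ (A : LocalAlgorithm DecompOutput) (k d c : ℕ → ℕ),
      IsPolylog A.rounds ∧ IsPolylog A.bits ∧ IsPolylog k ∧ IsPolylog d ∧ IsPolylog c ∧
      ∀ (n : ℕ), 1 ≤ n →
      ∀ (V : Type) [Fintype V], Fintype.card V ≤ n →
      ∀ (N : Network V), (∀ v, N.ident v ≤ n ^ a) →
      ∀ (Ω : Type) [MeasurableSpace Ω] (μ : Measure Ω) [IsProbabilityMeasure μ]
        (X : V × Fin (A.bits n) → Ω → Bool), IsKWiseIndepBits μ (k n) X →
        1 - 1 / (n : ℝ) ^ e ≤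
          μ.real {ω | IsNetworkDecomposition N (d n) (c n)
            (A.run N n fun v j => X (v, j) ω)} := by
  have hb := LocalDecomp.isPolylog_identBits a
  refine ⟨LocalDecomp.decompAlgorithm a, fun _ => 0, fun n => 2 * LocalDecomp.identBits a n,
    fun n => LocalDecomp.colorCount (LocalDecomp.identBits a n),
    IsPolylog.add (IsPolylog.decompRadius hb) (LocalDecomp.isPolylog_const 1),
    LocalDecomp.isPolylog_const 0, LocalDecomp.isPolylog_const 0,
    IsPolylog.mul (LocalDecomp.isPolylog_const 2) hb,
    IsPolylog.colorCount hb, ?_⟩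
  intro n _ V _ _ N hN Ω _ μ _ X _
  -- The run is correct for every value of the bits, so the event is the whole probability space.
  have h : {ω | IsNetworkDecomposition N (2 * LocalDecomp.identBits a n)
      (LocalDecomp.colorCount (LocalDecomp.identBits a n))
      ((LocalDecomp.decompAlgorithm a).run N n fun v j => X (v, j) ω)} = Set.univ :=
    Set.eq_univ_of_forall fun ω => LocalDecomp.decompAlgorithm_correct a n N hN _
  rw [h, probReal_univ]
  exact sub_le_self 1 (by positivity)
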